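/- Let $d\ge 1$ be an integer, let $p\ge 1$ be real with $d<6p$, and let $T>0$. Write $|\cdot|_{2p}$ for the norm of $L^{2p}(\mathbb R^d;\mathbb R)$. For $t>0$ and $x,y\in\mathbb R^d$ let $$K_{t;x,y}=(2\pi)^{-d}\int_{\mathbb R^d}e^{-\frac t8(-2+|\xi|^2)^2}\cos\langle \xi,x-y\rangle\,d\xi ,$$ the fundamental solution of $\partial_t u=-\frac18(\Delta+2)^2u$. For an integer $N\ge 1$ let $I_N(v)=v$ if $|v|_{2p}\le N$ and $I_N(v)=Nv/|v|_{2p}$ if $|v|_{2p}>N$, for $v\in L^{2p}(\mathbb R^d;\mathbb R)$. There is a constant $C\in(0,\infty)$, depending only on $d$, $p$ and $T$, such that for every $u_0\in L^{2p}(\mathbb R^d;\mathbb R)$ and every integer $N\ge 1$ there exists a unique $U_N\in C([0,T];L^{2p}(\mathbb R^d;\mathbb R))$ solving, for every $t\in[0,T]$ and almost every $x\in\mathbb R^d$ (all integrals existing as iterated Lebesgue integrals), the truncated mild equation $$U_N(t,x)=\int_{\mathbb R^d}K_{t;x,y}\,u_0(y)\,dy+\frac12\int_0^t\!\int_{\mathbb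 R^d}K_{t-s;x,y}\,(I_NU_N)(s,y)\,dy\,ds+\frac12\sum_{\ell=1}^d\int_0^t\!\int_{\mathbb R^d}\frac{\partial K_{t-s;x,y}}{\partial y_\ell}\,\big[(I_NU_N)(s,y)\big]^2\,dy\,ds ,$$ where $(I_NU_N)(s,\cdot)=I_N(U_N(s))$ and the first term on the right is read as $u_0(x)$ when $t=0$. Moreover $$\sup_{t\in[0,T]}|U_N(t)|_{2p}\le C\Big(|u_0|_{2p}+TN+d\,N^2\,T^{\frac{6p-d}{8p}}\Big)<\infty .$$ -/

import Mathlib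

open MeasureTheory Set

noncomputable section

/-- Euclidean space of dimension `d`. -/
abbrev Sp (d : ℕ) : Type := EuclideanSpace ℝ (Fin d)

/-- The space `L^{2p}(ℝ^d; ℝ)` for a real exponent `p`. -/
abbrev L2p (d : ℕ) (p : ℝ) : Type :=
  Lp ℝ (ENNReal.ofReal (2 * p)) (volume : Measure (Sp d))

/-- For `p ≥ 1` the exponent `2p` is at least `1`, so that `L^{2p}` is a normed space. -/
instance fact_one_le_two_mul (p : ℝ) [hp : Fact (1 ≤ p)] :
    Fact (1 ≤ ENNReal.ofReal (2 * p)) :=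
  ⟨by rw [ENNReal.one_le_ofReal]; linarith [hp.out]⟩

/-- The L-KS kernel in its Fourier form, the fundamental solution of
`∂ₜ u = -(1/8) (Δ + 2)² u`. -/
def lksKernel {d : ℕ} (t : ℝ) (x y : Sp d) : ℝ :=
  ((2 * Real.pi) ^ d)⁻¹ *
    ∫ ξ : Sp d, Real.exp (-(t / 8) * (-2 + ‖ξ‖ ^ 2) ^ 2) * Real.cos (inner ℝ ξ (x - y))

/-- The partial derivative of the L-KS kernel with respect to `y_ℓ`. -/
def lksKernelDeriv {d : ℕ} (l : Fin d) (t : ℝ) (x y : Sp d) : ℝ :=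
  lineDeriv ℝ (fun y' : Sp d => lksKernel t x y') y (EuclideanSpace.single l (1 : ℝ))

/-- The action of the kernel on initial data, equal to the data itself at time `0`. -/
def initConv {d : ℕ} (z : Sp d → ℝ) (t : ℝ) (x : Sp d) : ℝ :=
  if t = 0 then z x else ∫ y, lksKernel t x y * z y

/-- The space-time convolution `∫₀ᵗ ∫ G(t - r; x, y) u(r, y) dy dr`. -/
def spaceTimeConv {d : ℕ} (G : ℝ → Sp d → Sp d → ℝ) (u : ℝ → Sp d → ℝ)
    (t : ℝ) (x : Sp d) : ℝ :=
  ∫ r in (0 : ℝ)..t, ∫ y, G (t - r) x y * u r y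

/-- The integrals in `spaceTimeConv G u t x` exist as Lebesgue integrals. -/
def SpaceTimeConvExists {d : ℕ} (G : ℝ → Sp d → Sp d → ℝ) (u : ℝ → Sp d → ℝ)
    (t : ℝ) (x : Sp d) : Prop :=
  (∀ r ∈ Ioo 0 t, Integrable (fun y => G (t - r) x y * u r y)) ∧
    IntervalIntegrable (fun r => ∫ y, G (t - r) x y * u r y) volume 0 t

/-- The radial projection of `L^{2p}` onto the closed ball of radius `N` about the origin. -/
def ballProj {d : ℕ} {p : ℝ} (N : ℕ) (v : L2p d p) : L2p d p :=
  open Classical in if ‖v‖ ≤ N then v else ((N : ℝ) / ‖v‖) • v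

/-- `U` (through its values on `[0, T]`) is a solution in `C([0, T]; L^{2p})` of the mild
L-KS formulation of the Kuramoto-Sivashinsky-Burgers equation, truncated at level `N`. -/
structure IsTruncatedMildSolution {d : ℕ} {p : ℝ} [Fact (1 ≤ p)] (T : ℝ) (N : ℕ)
    (u₀ : L2p d p) (U : ℝ → L2p d p) : Prop where
  continuousOn : ContinuousOn U (Icc 0 T)
  integrable_init : ∀ t ∈ Ioc 0 T, ∀ᵐ x : Sp d, Integrable (fun y => lksKernel t x y * u₀ y)
  exists_linear : ∀ t ∈ Icc 0 T, ∀ᵐ x : Sp d,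
    SpaceTimeConvExists lksKernel (fun s y => ballProj N (U s) y) t x
  exists_burgers : ∀ t ∈ Icc 0 T, ∀ᵐ x : Sp d, ∀ l : Fin d,
    SpaceTimeConvExists (lksKernelDeriv l) (fun s y => (ballProj N (U s) y) ^ 2) t x
  mild_eq : ∀ t ∈ Icc 0 T, ∀ᵐ x : Sp d,
    U t x = initConv u₀ t x
      + (1 / 2) * spaceTimeConv lksKernel (fun s y => ballProj N (U s) y) t x
      + (1 / 2) * ∑ l : Fin d,
          spaceTimeConv (lksKernelDeriv l) (fun s y => (ballProj N (U s) y) ^ 2) t x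

end

/-! Truncation makes `v ↦ (I_N v, (I_N v)²)` bounded and globally Lipschitz from L^{2p} to L^{2p} ×
L^p. The mild equation thus becomes a Volterra equation U(t) = a(t) + ∫₀ᵗ R(t - r) G(U(r)) dr in
L^{2p}, with G Lipschitz and R(s) bounded operators satisfying ‖R(s)‖ ≤ C s^{-α}. Here α = 1/4 +
d/(8p), and α < 1 is exactly the condition d < 6p.

The exponent comes from the kernel. With s = √t, a Gaussian integral in an auxiliary variable l
linearizes the square in exp(-s²(-2 + |ξ|²)²/8). Shifting the linear term makes the integrand decay
like exp(-s|ξ|²), so the ξ-integral can be done explicitly. The kernel is therefore a superposition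
of complex Gaussians of variance parameter s(1 - il), damped by exp(-2l²). Balancing l² against
|z|²/(s(1 + l²)) gives decay exp(-|z|/(2 t^{1/4})). On (0, T] the L¹ and sup norms are then
O(t^{-β}) and O(t^{-β-d/4}), with β = 0 for the kernel and β = 1/4 for its gradient. Young's
inequality, interpolated between these two norms, gives the operator bounds
(`exists_norm_convLp_le`).

`exists_unique_volterra` solves the equation on all of [0, T] at once. After weighting by e^{-ct},
the contraction constant is a multiple of ∫₀ᵀ s^{-α} e^{-cs} ds, which vanishes as c → ∞. The free
term is continuous at t = 0 because the kernel is an approximate identity: its mass is its symbol at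
ξ = 0, namely e^{-t/2}.

The equation is stated with iterated Lebesgue integrals, whereas the fixed point argument uses
Bochner integrals in L^{2p}. `Lp.ae_integrable_and_integral_eq` identifies the two, and
`isTruncatedMildSolution_iff` makes the two notions of solution equivalent, so that uniqueness
transfers as well. The norm estimate needs no Gronwall argument: ‖I_N U‖ ≤ N and ‖(I_N U)²‖ ≤ N² are
integrated directly against 1 and s^{-α}, and 1 - α = (6p - d)/(8p). -/

noncomputable section

/-! ### Duhamel integrals with a weakly singular operator kernel. -/

open Filter Topology in
theorem intervalIntegrable_const_sub_rpow {α : ℝ} (hα : α < 1) (t : ℝ) :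
    IntervalIntegrable (fun r => (t - r) ^ (-α)) volume 0 t := by
  have h := (intervalIntegral.intervalIntegrable_rpow' (a := 0) (b := t)
    (by linarith : -1 < -α)).comp_sub_left t
  simpa using h.symm

/-- The integral `∫₀ᵗ R(t - r) g(r) dr` of a family of bounded operators along a path. -/
def duhamel {X E : Type*} [NormedAddCommGroup X] [NormedSpace ℝ X] [NormedAddCommGroup E]
    [NormedSpace ℝ E] (R : ℝ → X →L[ℝ] E) (g : ℝ → X) (t : ℝ) : E :=
  ∫ r in (0 : ℝ)..t, R (t - r) (g r)

section Duhamel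

variable {X E : Type*} [NormedAddCommGroup X] [NormedSpace ℝ X] [NormedAddCommGroup E]
  [NormedSpace ℝ E] {R : ℝ → X →L[ℝ] E} {T C α : ℝ}

theorem duhamel_continuousOn_integrand (hR : ContinuousOn R (Ioc 0 T)) {g : ℝ → X}
    (hg : ContinuousOn g (Icc 0 T)) {t : ℝ} (ht : t ∈ Icc 0 T) :
    ContinuousOn (fun r => R (t - r) (g r)) (Ioo 0 t) := by
  refine ContinuousOn.clm_apply (hR.comp (by fun_prop) ?_) (hg.mono ?_)
  · intro r hr
    exact ⟨by linarith [hr.2], by linarith [hr.1, ht.2]⟩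
  · intro r hr
    exact ⟨hr.1.le, by linarith [hr.2, ht.2]⟩

theorem duhamel_intervalIntegrable (hα : α < 1) (hR : ContinuousOn R (Ioc 0 T))
    (hRb : ∀ s ∈ Ioc 0 T, ‖R s‖ ≤ C * s ^ (-α)) {g : ℝ → X}
    (hg : ContinuousOn g (Icc 0 T)) {t : ℝ} (ht : t ∈ Icc 0 T) :
    IntervalIntegrable (fun r => R (t - r) (g r)) volume 0 t := by
  obtain ⟨M, hM⟩ := isCompact_Icc.exists_bound_of_continuousOn hg
  rw [intervalIntegrable_iff_integrableOn_Ioo_of_le ht.1]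
  have h1 := ((intervalIntegrable_const_sub_rpow hα t).const_mul C).mul_const M
  rw [intervalIntegrable_iff_integrableOn_Ioo_of_le ht.1] at h1
  refine Integrable.mono' h1
    ((duhamel_continuousOn_integrand hR hg ht).aestronglyMeasurable measurableSet_Ioo) ?_
  filter_upwards [ae_restrict_mem measurableSet_Ioo] with r hr
  have hs : t - r ∈ Ioc 0 T := ⟨by linarith [hr.2], by linarith [hr.1, ht.2]⟩
  calc ‖R (t - r) (g r)‖ ≤ ‖R (t - r)‖ * ‖g r‖ := (R (t - r)).le_opNorm _
    _ ≤ C * (t - r) ^ (-α) * M := by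
        refine mul_le_mul (hRb _ hs) (hM r ⟨hr.1.le, by linarith [hr.2, ht.2]⟩) (norm_nonneg _) ?_
        exact (norm_nonneg _).trans (hRb _ hs)

theorem integral_const_sub_rpow (hα : α < 1) (t : ℝ) :
    ∫ r in (0 : ℝ)..t, (t - r) ^ (-α) = t ^ (1 - α) / (1 - α) := by
  rw [intervalIntegral.integral_comp_sub_left (fun s => s ^ (-α)) t]
  rw [integral_rpow (Or.inl (by linarith))]
  have : -α + 1 = 1 - α := by ring
  simp [this, Real.zero_rpow (by linarith : (1 - α) ≠ 0)]

theorem norm_duhamel_le (hα : α < 1)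
    (hRb : ∀ s ∈ Ioc 0 T, ‖R s‖ ≤ C * s ^ (-α)) {g : ℝ → X} {M : ℝ}
    (hM : ∀ r ∈ Icc 0 T, ‖g r‖ ≤ M) {t : ℝ} (ht : t ∈ Icc 0 T) :
    ‖duhamel R g t‖ ≤ C * M * (t ^ (1 - α) / (1 - α)) := by
  rw [← integral_const_sub_rpow hα, ← intervalIntegral.integral_const_mul, duhamel,
    intervalIntegral.integral_of_le ht.1, intervalIntegral.integral_of_le ht.1,
    integral_Ioc_eq_integral_Ioo, integral_Ioc_eq_integral_Ioo]
  refine norm_integral_le_of_norm_le ?_ ?_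
  · have h1 := (intervalIntegrable_const_sub_rpow hα t).const_mul (C * M)
    rwa [intervalIntegrable_iff_integrableOn_Ioo_of_le ht.1] at h1
  · filter_upwards [ae_restrict_mem measurableSet_Ioo] with r hr
    have hs : t - r ∈ Ioc 0 T := ⟨by linarith [hr.2], by linarith [hr.1, ht.2]⟩
    calc ‖R (t - r) (g r)‖ ≤ ‖R (t - r)‖ * ‖g r‖ := (R (t - r)).le_opNorm _
      _ ≤ C * (t - r) ^ (-α) * M := by
          refine mul_le_mul (hRb _ hs) (hM r ⟨hr.1.le, by linarith [hr.2, ht.2]⟩) (norm_nonneg _) ?_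
          exact (norm_nonneg _).trans (hRb _ hs)
      _ = C * M * (t - r) ^ (-α) := by ring

/-- The substitution s = t - r fixes the singularity at s = 0, and the indicator fixes the domain.
The variable t then enters only through a bounded path and a cutoff, which is the form dominated
convergence needs. Extending g by its end values makes the integrand meaningful for every real t. -/
theorem duhamel_eq_integral_indicator (hT : 0 ≤ T) {g : ℝ → X} {t : ℝ} (ht : t ∈ Icc 0 T) :
    duhamel R g t = ∫ s in Ioc 0 T,
      (Ioi s).indicator (fun t => R s (IccExtend hT ((Icc 0 T).domRestrict g) (t - s))) t := by
  have h1 : duhamel R g t = ∫ s in (0 : ℝ)..t, R s (g (t - s)) := by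
    have := intervalIntegral.integral_comp_sub_left (a := 0) (b := t)
      (fun s => R s (g (t - s))) t
    simp only [sub_sub_cancel, sub_self, sub_zero] at this
    exact this
  rw [h1, intervalIntegral.integral_of_le ht.1, integral_Ioc_eq_integral_Ioo]
  have h2 : Ioo 0 t ⊆ Ioc 0 T := fun s hs => ⟨hs.1, by linarith [hs.2, ht.2]⟩
  rw [← integral_indicator measurableSet_Ioo, ← integral_indicator measurableSet_Ioc]
  congr 1
  ext s
  by_cases hs : s ∈ Ioo 0 t
  · rw [indicator_of_mem hs, indicator_of_mem (h2 hs), indicator_of_mem (show t ∈ Ioi s from hs.2),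
      IccExtend_of_mem]
    · rfl
    · exact ⟨by linarith [hs.2], by linarith [hs.1, ht.2]⟩
  · rw [indicator_of_notMem hs]
    by_cases hs' : s ∈ Ioc 0 T
    · rw [indicator_of_mem hs', indicator_of_notMem]
      exact fun h => hs ⟨hs'.1, h⟩
    · rw [indicator_of_notMem hs']

open Filter Topology in
theorem continuousOn_duhamel (hT : 0 ≤ T) (hα : α < 1) (hR : ContinuousOn R (Ioc 0 T))
    (hRb : ∀ s ∈ Ioc 0 T, ‖R s‖ ≤ C * s ^ (-α)) {g : ℝ → X}
    (hg : ContinuousOn g (Icc 0 T)) : ContinuousOn (duhamel R g) (Icc 0 T) := by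
  obtain ⟨M, hM⟩ := isCompact_Icc.exists_bound_of_continuousOn hg
  set G := IccExtend hT ((Icc 0 T).domRestrict g) with hG
  have hGc : Continuous G := (continuousOn_iff_continuous_domRestrict.1 hg).Icc_extend'
  have hGM : ∀ r, ‖G r‖ ≤ M := fun r => hM _ (projIcc 0 T hT r).2
  refine ContinuousOn.congr (f := fun t => ∫ s in Ioc 0 T,
      (Ioi s).indicator (fun t => R s (G (t - s))) t) ?_
    fun t ht => duhamel_eq_integral_indicator hT ht
  refine Continuous.continuousOn (continuous_iff_continuousAt.2 fun t₀ => ?_)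
  refine continuousAt_of_dominated (bound := fun s => C * s ^ (-α) * M) ?_ ?_ ?_ ?_
  · refine Eventually.of_forall fun t => ?_
    have h : ContinuousOn (fun s => R s (G (t - s))) (Ioc 0 T) :=
      hR.clm_apply (by fun_prop)
    have h2 := (h.aestronglyMeasurable measurableSet_Ioc (μ := volume)).indicator
      (measurableSet_Iio (a := t))
    convert h2 using 2 with s
    simp [indicator, mem_Ioi, mem_Iio]
  · refine Eventually.of_forall fun t => ?_
    filter_upwards [ae_restrict_mem measurableSet_Ioc] with s hs
    refine (norm_indicator_le_norm_self _ _).trans ?_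
    refine ((R s).le_opNorm _).trans ?_
    exact mul_le_mul (hRb _ hs) (hGM _) (norm_nonneg _) ((norm_nonneg _).trans (hRb _ hs))
  · have h1 := ((intervalIntegral.intervalIntegrable_rpow' (a := 0) (b := T)
      (by linarith : -1 < -α)).const_mul C).mul_const M
    rwa [intervalIntegrable_iff_integrableOn_Ioc_of_le hT] at h1
  -- The cutoff jumps only at t = s, so continuity in t at t₀ can fail only for the single value s =
  -- t₀.
  · have : ∀ᵐ s ∂(volume.restrict (Ioc 0 T)), s ≠ t₀ := ae_restrict_of_ae (Measure.ae_ne volume t₀)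
    filter_upwards [this] with s hs
    have hc : Continuous fun t => R s (G (t - s)) := by fun_prop
    rcases lt_or_gt_of_ne hs with h | h
    · refine hc.continuousAt.congr ?_
      filter_upwards [Ioi_mem_nhds h] with t ht
      rw [indicator_of_mem ht]
    · refine (continuousAt_const (y := (0 : E))).congr ?_
      filter_upwards [Iio_mem_nhds h] with t ht
      rw [indicator_of_notMem]
      exact not_lt.2 (mem_Iio.1 ht).le

end Duhamel

/-! ### Volterra equations: global contraction in an exponentially weighted norm. -/

open Filter Topology in
theorem tendsto_integral_rpow_mul_exp_neg {α : ℝ} (hα : α < 1) (T : ℝ) :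
    Tendsto (fun c : ℝ => ∫ s in Ioc 0 T, s ^ (-α) * Real.exp (-(c * s))) atTop (𝓝 0) := by
  by_cases hT : 0 ≤ T
  swap
  · simp [Ioc_eq_empty_of_le (not_le.1 hT).le]
  suffices h : Tendsto (fun c : ℝ => ∫ s in Ioc 0 T, s ^ (-α) * Real.exp (-(c * s))) atTop
      (𝓝 (∫ s in Ioc 0 T, (0 : ℝ))) by simpa using h
  refine tendsto_integral_filter_of_dominated_convergence (l := atTop) (fun s => s ^ (-α)) ?_ ?_ ?_ ?_
  · exact Eventually.of_forall fun c => by fun_prop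
  · filter_upwards [eventually_ge_atTop 0] with c hc
    filter_upwards [ae_restrict_mem measurableSet_Ioc] with s hs
    have h1 : 0 ≤ s ^ (-α) := Real.rpow_nonneg hs.1.le _
    rw [Real.norm_of_nonneg (mul_nonneg h1 (Real.exp_nonneg _))]
    exact mul_le_of_le_one_right h1 (Real.exp_le_one_iff.2 (by nlinarith [hs.1]))
  · have h1 := intervalIntegral.intervalIntegrable_rpow' (a := 0) (b := T)
      (by linarith : -1 < -α)
    rwa [intervalIntegrable_iff_integrableOn_Ioc_of_le hT] at h1
  · filter_upwards [ae_restrict_mem measurableSet_Ioc] with s hs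
    have h1 : Tendsto (fun c : ℝ => Real.exp (-(c * s))) atTop (𝓝 0) :=
      Real.tendsto_exp_neg_atTop_nhds_zero.comp (tendsto_id.atTop_mul_const hs.1)
    simpa using h1.const_mul (s ^ (-α))

section Volterra

variable {X E : Type*} [NormedAddCommGroup X] [NormedSpace ℝ X] [NormedAddCommGroup E]
  [NormedSpace ℝ E] {R : ℝ → X →L[ℝ] E} {T C α : ℝ}

/-- Since e^{c(t-s)} = e^{ct} e^{-cs}, the weight splits: e^{ct} is returned on the right and
e^{-cs} damps the singular kernel. Enlarging the domain from (0, t) to (0, T] makes the constant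
independent of t. -/
theorem norm_duhamel_sub_le (hT : 0 ≤ T) (hα : α < 1) (hR : ContinuousOn R (Ioc 0 T))
    (hRb : ∀ s ∈ Ioc 0 T, ‖R s‖ ≤ C * s ^ (-α)) (hC : 0 ≤ C) {g₁ g₂ : ℝ → X}
    (hg₁ : ContinuousOn g₁ (Icc 0 T)) (hg₂ : ContinuousOn g₂ (Icc 0 T)) {c D : ℝ}
    (hD : ∀ r ∈ Icc 0 T, ‖g₁ r - g₂ r‖ ≤ D * Real.exp (c * r)) {t : ℝ} (ht : t ∈ Icc 0 T) :
    ‖duhamel R g₁ t - duhamel R g₂ t‖ ≤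
      C * D * (∫ s in Ioc 0 T, s ^ (-α) * Real.exp (-(c * s))) * Real.exp (c * t) := by
  have hD0 : 0 ≤ D := by
    have := (norm_nonneg _).trans (hD 0 ⟨le_rfl, hT⟩)
    simpa using this
  have hi : IntegrableOn (fun s => s ^ (-α) * Real.exp (-(c * s))) (Ioc 0 T) := by
    rw [← intervalIntegrable_iff_integrableOn_Ioc_of_le hT]
    exact (intervalIntegral.intervalIntegrable_rpow' (by linarith)).mul_continuousOn
      (by fun_prop)
  have e1 : duhamel R g₁ t - duhamel R g₂ t = ∫ r in (0 : ℝ)..t, R (t - r) (g₁ r - g₂ r) := by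
    rw [duhamel, duhamel, ← intervalIntegral.integral_sub
      (duhamel_intervalIntegrable hα hR hRb hg₁ ht) (duhamel_intervalIntegrable hα hR hRb hg₂ ht)]
    simp
  have e2 : ∫ r in (0 : ℝ)..t, R (t - r) (g₁ r - g₂ r) =
      ∫ s in (0 : ℝ)..t, R s (g₁ (t - s) - g₂ (t - s)) := by
    have := intervalIntegral.integral_comp_sub_left (a := 0) (b := t)
      (fun s => R s (g₁ (t - s) - g₂ (t - s))) t
    simp only [sub_sub_cancel, sub_self, sub_zero] at this
    exact this
  have hsub : Ioo 0 t ⊆ Ioc 0 T := fun s hs => ⟨hs.1, by linarith [hs.2, ht.2]⟩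
  rw [e1, e2, intervalIntegral.integral_of_le ht.1, integral_Ioc_eq_integral_Ioo]
  calc _ ≤ ∫ s in Ioo 0 t, C * D * Real.exp (c * t) * (s ^ (-α) * Real.exp (-(c * s))) := by
        refine norm_integral_le_of_norm_le ((hi.mono_set hsub).const_mul _) ?_
        filter_upwards [ae_restrict_mem measurableSet_Ioo] with s hs
        have h3 : t - s ∈ Icc 0 T := ⟨by linarith [hs.2], by linarith [hs.1, ht.2]⟩
        calc _ ≤ ‖R s‖ * ‖g₁ (t - s) - g₂ (t - s)‖ := (R s).le_opNorm _
          _ ≤ C * s ^ (-α) * (D * Real.exp (c * (t - s))) :=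
              mul_le_mul (hRb _ (hsub hs)) (hD _ h3) (norm_nonneg _)
                ((norm_nonneg _).trans (hRb _ (hsub hs)))
          _ = _ := by rw [mul_sub, sub_eq_add_neg, Real.exp_add]; ring
    _ ≤ C * D * Real.exp (c * t) * ∫ s in Ioc 0 T, s ^ (-α) * Real.exp (-(c * s)) := by
        rw [integral_const_mul]
        refine mul_le_mul_of_nonneg_left (setIntegral_mono_set hi ?_ hsub.eventuallyLE)
          (by positivity)
        filter_upwards [ae_restrict_mem measurableSet_Ioc] with s hs
        exact mul_nonneg (Real.rpow_nonneg hs.1.le _) (Real.exp_nonneg _)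
    _ = _ := by ring

open Filter Topology in
/-- A Volterra equation with weakly singular operator kernel and Lipschitz nonlinearity has a
unique continuous solution on every bounded interval. -/
theorem exists_unique_volterra [CompleteSpace E] (hT : 0 ≤ T) (hα : α < 1) (hR : ContinuousOn R (Ioc 0 T))
    (hRb : ∀ s ∈ Ioc 0 T, ‖R s‖ ≤ C * s ^ (-α)) (hC : 0 ≤ C) {a : ℝ → E}
    (ha : ContinuousOn a (Icc 0 T)) {G : E → X} {K : NNReal} (hG : LipschitzWith K G) :
    ∃ U : ℝ → E, (ContinuousOn U (Icc 0 T) ∧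
        ∀ t ∈ Icc 0 T, U t = a t + duhamel R (fun r => G (U r)) t) ∧
      ∀ V : ℝ → E, ContinuousOn V (Icc 0 T) →
        (∀ t ∈ Icc 0 T, V t = a t + duhamel R (fun r => G (V r)) t) → EqOn V U (Icc 0 T) := by
  -- A large weight c pushes the contraction constant below 1/2 on the whole interval, so no gluing
  -- of short-time solutions is needed.
  obtain ⟨c, hc⟩ : ∃ c : ℝ, C * K * (∫ s in Ioc 0 T, s ^ (-α) * Real.exp (-(c * s))) < 1 / 2 := by
    have h := (tendsto_integral_rpow_mul_exp_neg hα T).const_mul (C * K)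
    rw [mul_zero] at h
    exact (h.eventually_lt_const (by norm_num)).exists
  -- The unknown is W = e^{-ct} U, whose plain sup norm on [0, T] is the weighted norm of U; `P`
  -- recovers U from W.
  set P : C(Icc 0 T, E) → ℝ → E := fun W r => Real.exp (c * r) • IccExtend hT W r with hP
  have hPc : ∀ W, Continuous (P W) := fun W =>
    (by fun_prop : Continuous fun r : ℝ => Real.exp (c * r)).smul W.continuous.Icc_extend'
  have hGP : ∀ W, ContinuousOn (fun r => G (P W r)) (Icc 0 T) := fun W =>
    (hG.continuous.comp (hPc W)).continuousOn
  have hΦ : ∀ W, ContinuousOn (fun t => Real.exp (-(c * t)) •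
      (a t + duhamel R (fun r => G (P W r)) t)) (Icc 0 T) := fun W =>
    (by fun_prop : Continuous fun r : ℝ => Real.exp (-(c * r))).continuousOn.smul
      (ha.add (continuousOn_duhamel hT hα hR hRb (hGP W)))
  set Φ : C(Icc 0 T, E) → C(Icc 0 T, E) := fun W =>
    ⟨_, continuousOn_iff_continuous_domRestrict.1 (hΦ W)⟩ with hΦdef
  have hcontr : ContractingWith (1 / 2) Φ := by
    refine ⟨by norm_num, LipschitzWith.of_dist_le_mul fun W₁ W₂ => ?_⟩
    rw [ContinuousMap.dist_le (by positivity)]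
    intro t
    have hD : ∀ r ∈ Icc 0 T, ‖G (P W₁ r) - G (P W₂ r)‖ ≤
        (K * dist W₁ W₂) * Real.exp (c * r) := by
      intro r hr
      rw [← dist_eq_norm]
      refine (hG.dist_le_mul _ _).trans ?_
      rw [mul_assoc]
      refine mul_le_mul_of_nonneg_left ?_ K.2
      simp only [hP]
      rw [dist_eq_norm, ← smul_sub, norm_smul, Real.norm_of_nonneg (Real.exp_nonneg _), mul_comm,
        ← dist_eq_norm]
      exact mul_le_mul_of_nonneg_right (ContinuousMap.dist_apply_le_dist _) (Real.exp_nonneg _)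
    have h := norm_duhamel_sub_le hT hα hR hRb hC (hGP W₁) (hGP W₂) hD t.2
    have e : Φ W₁ t - Φ W₂ t = Real.exp (-(c * t)) •
        (duhamel R (fun r => G (P W₁ r)) t - duhamel R (fun r => G (P W₂ r)) t) := by
      simp only [hΦdef, ContinuousMap.coe_mk, domRestrict_apply, ← smul_sub]
      congr 1
      abel
    rw [dist_eq_norm, e, norm_smul, Real.norm_of_nonneg (Real.exp_nonneg _)]
    calc _ ≤ Real.exp (-(c * t)) * (C * (K * dist W₁ W₂) *
          (∫ s in Ioc 0 T, s ^ (-α) * Real.exp (-(c * s))) * Real.exp (c * t)) :=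
          mul_le_mul_of_nonneg_left h (Real.exp_nonneg _)
      _ = (C * K * (∫ s in Ioc 0 T, s ^ (-α) * Real.exp (-(c * s)))) * dist W₁ W₂ *
          (Real.exp (-(c * t)) * Real.exp (c * t)) := by ring
      _ = (C * K * (∫ s in Ioc 0 T, s ^ (-α) * Real.exp (-(c * s)))) * dist W₁ W₂ := by
          rw [← Real.exp_add]; simp
      _ ≤ _ := mul_le_mul_of_nonneg_right (by simpa using hc.le) dist_nonneg
  have hcongr : ∀ {g₁ g₂ : ℝ → E} {t : ℝ}, t ∈ Icc 0 T → EqOn g₁ g₂ (Icc 0 T) →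
      duhamel R (fun r => G (g₁ r)) t = duhamel R (fun r => G (g₂ r)) t := by
    intro g₁ g₂ t ht h
    refine intervalIntegral.integral_congr fun r hr => ?_
    rw [uIcc_of_le ht.1] at hr
    simp only [h ⟨hr.1, hr.2.trans ht.2⟩]
  set W := ContractingWith.fixedPoint Φ hcontr with hW
  have hfix : Φ W = W := hcontr.fixedPoint_isFixedPt
  refine ⟨P W, ⟨(hPc W).continuousOn, fun t ht => ?_⟩, fun V hV hVeq t ht => ?_⟩
  · have h1 : W ⟨t, ht⟩ = Real.exp (-(c * t)) • (a t + duhamel R (fun r => G (P W r)) t) := by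
      conv_lhs => rw [← hfix]
      rfl
    simp only [hP]
    rw [IccExtend_of_mem hT W ht, h1, smul_smul, ← Real.exp_add]
    simp
    rfl
  -- Any other continuous solution, once weighted, is also a fixed point of `Φ`.
  · have hV' : ContinuousOn (fun t => Real.exp (-(c * t)) • V t) (Icc 0 T) :=
      (by fun_prop : Continuous fun r : ℝ => Real.exp (-(c * r))).continuousOn.smul hV
    set W' : C(Icc 0 T, E) := ⟨_, continuousOn_iff_continuous_domRestrict.1 hV'⟩ with hW'
    have hPV : EqOn (P W') V (Icc 0 T) := by
      intro r hr
      simp only [hP]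
      rw [IccExtend_of_mem hT W' hr]
      simp only [hW', ContinuousMap.coe_mk, domRestrict_apply]
      rw [smul_smul, ← Real.exp_add]
      simp
    have hfix' : Φ W' = W' := by
      ext r
      simp only [hΦdef, hW', ContinuousMap.coe_mk, domRestrict_apply]
      rw [hVeq r r.2, hcongr r.2 hPV]
    have : W' = W := hcontr.fixedPoint_unique hfix'
    rw [← hPV ht, this]

end Volterra

end

/-! ### Bochner integrals in L^r evaluated pointwise. -/

noncomputable section

section LpIntegral

open scoped ENNReal

variable {X : Type*} [MeasurableSpace X] {μ : Measure X} {r : ℝ≥0∞} [hr : Fact (1 ≤ r)]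

/-- Hölder on a set of finite measure, with constant μ(A)^{1 - 1/r}. For r = ∞ the convention 1 / 0
= 0 yields the correct exponent 1. -/
theorem MeasureTheory.Lp.exists_setIntegral_norm_le {A : Set X} (hA : μ A ≠ ∞) :
    ∃ C : ℝ, 0 ≤ C ∧ ∀ v : Lp ℝ r μ, IntegrableOn v A μ ∧ ∫ x in A, ‖v x‖ ∂μ ≤ C * ‖v‖ := by
  have : IsFiniteMeasure (μ.restrict A) := ⟨by simpa using hA.lt_top⟩
  have hfin : (μ.restrict A) univ ^ (1 / (1 : ℝ≥0∞).toReal - 1 / r.toReal) ≠ ∞ := by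
    refine ENNReal.rpow_ne_top_of_nonneg ?_ (by simpa using hA)
    rcases eq_or_ne r ∞ with h | h
    · simp [h]
    · have : 1 ≤ r.toReal := by
        rw [← ENNReal.toReal_one]
        exact (ENNReal.toReal_le_toReal (by simp) h).2 hr.out
      simp only [ENNReal.toReal_one, div_one, sub_nonneg]
      rw [div_le_one (by linarith)]
      exact this
  refine ⟨((μ.restrict A) univ ^ (1 / (1 : ℝ≥0∞).toReal - 1 / r.toReal)).toReal,
    ENNReal.toReal_nonneg, fun v => ?_⟩
  have hv : MemLp v r (μ.restrict A) := (Lp.memLp v).restrict A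
  have h1 : eLpNorm v 1 (μ.restrict A) ≤ eLpNorm v r μ *
      (μ.restrict A) univ ^ (1 / (1 : ℝ≥0∞).toReal - 1 / r.toReal) := by
    refine (eLpNorm_le_eLpNorm_mul_rpow_measure_univ hr.out hv.1).trans ?_
    refine mul_le_mul_left ?_ _
    exact eLpNorm_mono_measure (f := v) Measure.restrict_le_self
  refine ⟨hv.integrable hr.out, ?_⟩
  rw [integral_norm_eq_lintegral_enorm hv.1, ← eLpNorm_one_eq_lintegral_enorm, Lp.norm_def,
    mul_comm, ← ENNReal.toReal_mul]
  exact (ENNReal.toReal_le_toReal (ne_top_of_le_ne_top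
    (ENNReal.mul_ne_top (Lp.eLpNorm_ne_top v) hfin) h1)
    (ENNReal.mul_ne_top (Lp.eLpNorm_ne_top v) hfin)).2 h1

/-- These functionals separate points of L^r for σ-finite μ and, being continuous, commute with
Bochner integrals. -/
theorem MeasureTheory.Lp.exists_clm_setIntegral {A : Set X} (hA : μ A ≠ ∞) :
    ∃ φ : Lp ℝ r μ →L[ℝ] ℝ, ∀ v, φ v = ∫ x in A, v x ∂μ := by
  obtain ⟨C, -, hC⟩ := Lp.exists_setIntegral_norm_le (μ := μ) (r := r) hA
  refine ⟨LinearMap.mkContinuous ⟨⟨fun v => ∫ x in A, v x ∂μ, fun v w => ?_⟩, fun c v => ?_⟩ C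
    fun v => ?_, fun v => rfl⟩
  · rw [← integral_add (hC v).1 (hC w).1]
    exact integral_congr_ae (ae_restrict_of_ae (Lp.coeFn_add v w))
  · simp only [RingHom.id_apply]
    rw [← integral_smul]
    exact integral_congr_ae (ae_restrict_of_ae (Lp.coeFn_smul c v))
  · exact (norm_integral_le_integral_norm _).trans (hC v).2

/-- The Bochner integral of an `Lp`-valued function is computed pointwise. -/
theorem MeasureTheory.Lp.ae_integrable_and_integral_eq [SigmaFinite μ] {Ω : Type*} [MeasurableSpace Ω]
    {ν : Measure Ω} [SFinite ν] {f : Ω → Lp ℝ r μ} {F : Ω → X → ℝ} (hf : Integrable f ν)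
    (hF : AEStronglyMeasurable (Function.uncurry F) (ν.prod μ))
    (h : ∀ᵐ ω ∂ν, f ω =ᵐ[μ] F ω) :
    (∀ᵐ x ∂μ, Integrable (fun ω => F ω x) ν) ∧
      (∫ ω, f ω ∂ν : Lp ℝ r μ) =ᵐ[μ] fun x => ∫ ω, F ω x ∂ν := by
  -- Local integrability on the product is what permits Fubini. Both claims are then tested on sets
  -- of finite measure, which suffices by σ-finiteness.
  have key : ∀ A : Set X, MeasurableSet A → μ A < ∞ →
      Integrable (Function.uncurry F) (ν.prod (μ.restrict A)) := by
    intro A _ hA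
    obtain ⟨C, hC0, hC⟩ := Lp.exists_setIntegral_norm_le (μ := μ) (r := r) hA.ne
    have hFA : AEStronglyMeasurable (Function.uncurry F) (ν.prod (μ.restrict A)) :=
      hF.mono_ac (Measure.AbsolutelyContinuous.rfl.prod Measure.restrict_le_self.absolutelyContinuous)
    rw [integrable_prod_iff hFA]
    refine ⟨?_, ?_⟩
    · filter_upwards [h] with ω hω
      exact (hC (f ω)).1.congr (ae_restrict_of_ae hω)
    · refine Integrable.mono' (hf.norm.const_mul C) hFA.norm.integral_prod_right' ?_
      filter_upwards [h] with ω hω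
      rw [Real.norm_of_nonneg (integral_nonneg fun _ => norm_nonneg _)]
      refine le_trans (le_of_eq ?_) (hC (f ω)).2
      refine integral_congr_ae (ae_restrict_of_ae ?_)
      filter_upwards [hω] with x hx
      simp [Function.uncurry, hx]
  refine ⟨?_, ?_⟩
  · refine ae_of_forall_measure_lt_top_ae_restrict _ fun A hA hA' => ?_
    exact (key A hA hA').prod_left_ae
  · refine ae_eq_of_forall_setIntegral_eq_of_sigmaFinite ?_ ?_ ?_
    · intro A _ hA
      obtain ⟨C, -, hC⟩ := Lp.exists_setIntegral_norm_le (μ := μ) (r := r) hA.ne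
      exact (hC _).1
    · intro A hA hA'
      exact (key A hA hA').integral_prod_right
    · intro A hA hA'
      obtain ⟨φ, hφ⟩ := Lp.exists_clm_setIntegral (μ := μ) (r := r) hA'.ne
      rw [← hφ, ← φ.integral_comp_comm hf]
      rw [← integral_integral_swap (key A hA hA')]
      refine integral_congr_ae ?_
      filter_upwards [h] with ω hω
      rw [hφ]
      exact integral_congr_ae (ae_restrict_of_ae hω)

end LpIntegral

end

/-! ### Young's inequality and convolution operators from L^q to L^r. -/

noncomputable section

open scoped ENNReal

/-- Hölder applied to ab = a^{1-1/q} (a b^q)^{1/q}, that is, Jensen for the unnormalized measure a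
dμ. It drives both Young's inequality and the approximate identity estimate. -/
theorem ENNReal.lintegral_mul_rpow_le {α : Type*} [MeasurableSpace α] {μ : Measure α}
    {a b : α → ℝ≥0∞} (ha : AEMeasurable a μ) (hb : AEMeasurable b μ) {q : ℝ} (hq : 1 ≤ q) :
    (∫⁻ y, a y * b y ∂μ) ^ q ≤ (∫⁻ y, a y ∂μ) ^ (q - 1) * ∫⁻ y, a y * b y ^ q ∂μ := by
  have hq0 : 0 < q := by linarith
  have h1 : 0 ≤ 1 - 1 / q := by
    rw [sub_nonneg, div_le_one hq0]; exact hq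
  have h := ENNReal.lintegral_mul_norm_pow_le (μ := μ) ha (ha.mul (hb.pow_const q))
    (p := 1 - 1 / q) (q := 1 / q) h1 (by positivity) (by ring)
  have e : ∀ y, a y ^ (1 - 1 / q) * (a y * b y ^ q) ^ (1 / q) = a y * b y := by
    intro y
    rw [ENNReal.mul_rpow_of_nonneg _ _ (by positivity), ← ENNReal.rpow_mul, mul_one_div_cancel
      hq0.ne', ENNReal.rpow_one, ← mul_assoc, ← ENNReal.rpow_add_of_nonneg _ _ h1 (by positivity)]
    simp
  simp only [Pi.mul_apply, e] at h
  calc _ ≤ ((∫⁻ y, a y ∂μ) ^ (1 - 1 / q) * (∫⁻ y, a y * b y ^ q ∂μ) ^ (1 / q)) ^ q :=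
        ENNReal.rpow_le_rpow h hq0.le
    _ = _ := by
        rw [ENNReal.mul_rpow_of_nonneg _ _ hq0.le, ← ENNReal.rpow_mul, ← ENNReal.rpow_mul]
        congr 2
        · field_simp
        · rw [one_div_mul_cancel hq0.ne', ENNReal.rpow_one]

section Young

variable {d : ℕ}

/-- The convolution `∫ k(x - y) w(y) dy`. -/
def convFun (k w : Sp d → ℝ) (x : Sp d) : ℝ := ∫ y, k (x - y) * w y

/-- Measurable, integrable and bounded convolution kernels. -/
structure IsBddKernel (k : Sp d → ℝ) : Prop where
  measurable : Measurable k
  integrable : Integrable k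
  bdd : ∃ B : ℝ, ∀ z, |k z| ≤ B

theorem IsBddKernel.sub {k k' : Sp d → ℝ} (hk : IsBddKernel k) (hk' : IsBddKernel k') :
    IsBddKernel (k - k') := by
  obtain ⟨B, hB⟩ := hk.bdd
  obtain ⟨B', hB'⟩ := hk'.bdd
  exact ⟨hk.measurable.sub hk'.measurable, hk.integrable.sub hk'.integrable, B + B',
    fun z => (abs_sub _ _).trans (add_le_add (hB z) (hB' z))⟩

/-- The convolution of the absolute values of `k` and `w`. -/
def absConv (k w : Sp d → ℝ) (x : Sp d) : ℝ≥0∞ := ∫⁻ y, ‖k (x - y)‖ₑ * ‖w y‖ₑ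

variable {k w : Sp d → ℝ} {q r : ℝ}

theorem absConv_rpow_le (hk : Measurable k) (hw : AEMeasurable w) (hq : 1 ≤ q) (x : Sp d) :
    absConv k w x ^ q ≤ (∫⁻ z, ‖k z‖ₑ) ^ (q - 1) * ∫⁻ y, ‖k (x - y)‖ₑ * ‖w y‖ₑ ^ q := by
  rw [← lintegral_sub_left_eq_self (fun z => ‖k z‖ₑ) x]
  exact ENNReal.lintegral_mul_rpow_le (by fun_prop) hw.enorm hq

theorem absConv_rpow_le_sup (hk : Measurable k) (hw : AEMeasurable w) (hq : 1 ≤ q) {B : ℝ≥0∞}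
    (hB : ∀ z, ‖k z‖ₑ ≤ B) (x : Sp d) :
    absConv k w x ^ q ≤ (∫⁻ z, ‖k z‖ₑ) ^ (q - 1) * (B * ∫⁻ y, ‖w y‖ₑ ^ q) := by
  refine (absConv_rpow_le hk hw hq x).trans ?_
  gcongr
  rw [← lintegral_const_mul'' _ (hw.enorm.pow_const q)]
  exact lintegral_mono fun y => by gcongr; exact hB _

theorem lintegral_absConv_rpow_le (hk : Measurable k) (hw : AEMeasurable w) (hq : 1 ≤ q) :
    ∫⁻ x, absConv k w x ^ q ≤ (∫⁻ z, ‖k z‖ₑ) ^ q * ∫⁻ y, ‖w y‖ₑ ^ q := by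
  have hm : AEMeasurable (Function.uncurry fun x y : Sp d => ‖k (x - y)‖ₑ * ‖w y‖ₑ ^ q)
      (volume.prod volume) := by
    have h1 : Measurable fun z : Sp d × Sp d => ‖k (z.1 - z.2)‖ₑ := by fun_prop
    exact h1.aemeasurable.mul
      ((hw.enorm.pow_const q).comp_quasiMeasurePreserving Measure.quasiMeasurePreserving_snd)
  calc ∫⁻ x, absConv k w x ^ q
      ≤ ∫⁻ x, (∫⁻ z, ‖k z‖ₑ) ^ (q - 1) * ∫⁻ y, ‖k (x - y)‖ₑ * ‖w y‖ₑ ^ q :=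
        lintegral_mono fun x => absConv_rpow_le hk hw hq x
    _ = (∫⁻ z, ‖k z‖ₑ) ^ (q - 1) * ∫⁻ x, ∫⁻ y, ‖k (x - y)‖ₑ * ‖w y‖ₑ ^ q :=
        lintegral_const_mul'' _ hm.lintegral_prod_right'
    _ = (∫⁻ z, ‖k z‖ₑ) ^ (q - 1) * ((∫⁻ z, ‖k z‖ₑ) * ∫⁻ y, ‖w y‖ₑ ^ q) := by
        rw [lintegral_lintegral_swap hm, ← lintegral_const_mul'' _ (hw.enorm.pow_const q)]
        congr 1
        refine lintegral_congr fun y => ?_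
        rw [lintegral_mul_const _ (by fun_prop),
          lintegral_sub_right_eq_self (fun z => ‖k z‖ₑ) y]
    _ = _ := by
        rw [← mul_assoc]
        congr 1
        conv_lhs => rw [← ENNReal.rpow_one (∫⁻ z, ‖k z‖ₑ), ← ENNReal.rpow_mul, one_mul]
        rw [← ENNReal.rpow_add_of_nonneg _ _ (by linarith) (by linarith)]
        simp

/-- The power r is split as (r - q) + q: the first part is controlled by the pointwise bound
`absConv_rpow_le_sup`, the second by the L^q → L^q bound. The remainder is bookkeeping of exponents.
-/
theorem lintegral_absConv_rpow_le' (hk : Measurable k) (hw : AEMeasurable w) (hq : 1 ≤ q)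
    (hqr : q ≤ r) {B : ℝ≥0∞} (hB : ∀ z, ‖k z‖ₑ ≤ B) :
    (∫⁻ x, absConv k w x ^ r) ^ (1 / r) ≤ (∫⁻ z, ‖k z‖ₑ) ^ (1 - (1 / q - 1 / r)) *
      B ^ (1 / q - 1 / r) * (∫⁻ y, ‖w y‖ₑ ^ q) ^ (1 / q) := by
  have hq0 : 0 < q := by linarith
  have hr0 : 0 < r := by linarith
  set A := ∫⁻ z, ‖k z‖ₑ
  set W := ∫⁻ y, ‖w y‖ₑ ^ q
  have h0 : 0 ≤ (r - q) / q := div_nonneg (by linarith) hq0.le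
  have h1 : ∫⁻ x, absConv k w x ^ r ≤ (A ^ (q - 1) * (B * W)) ^ ((r - q) / q) * (A ^ q * W) := by
    calc _ ≤ ∫⁻ x, (A ^ (q - 1) * (B * W)) ^ ((r - q) / q) * absConv k w x ^ q := by
          refine lintegral_mono fun x => ?_
          have e : absConv k w x ^ r = (absConv k w x ^ q) ^ ((r - q) / q) * absConv k w x ^ q := by
            rw [← ENNReal.rpow_mul, ← ENNReal.rpow_add_of_nonneg _ _ (by positivity) hq0.le]
            congr 1
            field_simp
            ring
          simp only [e]
          gcongr
          exact absConv_rpow_le_sup hk hw hq hB x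
      _ ≤ _ := by
          have hm : AEMeasurable (Function.uncurry fun x y : Sp d => ‖k (x - y)‖ₑ * ‖w y‖ₑ)
              (volume.prod volume) := by
            have h1 : Measurable fun z : Sp d × Sp d => ‖k (z.1 - z.2)‖ₑ := by fun_prop
            exact h1.aemeasurable.mul
              (hw.enorm.comp_quasiMeasurePreserving Measure.quasiMeasurePreserving_snd)
          have hm' : AEMeasurable (fun x => absConv k w x ^ q) :=
            hm.lintegral_prod_right'.pow_const q
          rw [lintegral_const_mul'' _ hm']
          gcongr
          exact lintegral_absConv_rpow_le hk hw hq
  refine (ENNReal.rpow_le_rpow h1 (by positivity : 0 ≤ 1 / r)).trans (le_of_eq ?_)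
  have hb : 0 ≤ 1 / q - 1 / r := by
    rw [sub_nonneg]; exact one_div_le_one_div_of_le hq0 hqr
  have hA : 0 ≤ (q - 1) * ((r - q) / q) := mul_nonneg (by linarith) h0
  rw [ENNReal.mul_rpow_of_nonneg _ _ h0, ENNReal.mul_rpow_of_nonneg _ _ h0,
    ← ENNReal.rpow_mul]
  have e : A ^ ((q - 1) * ((r - q) / q)) * (B ^ ((r - q) / q) * W ^ ((r - q) / q)) * (A ^ q * W) =
      A ^ ((q - 1) * ((r - q) / q) + q) * B ^ ((r - q) / q) * W ^ ((r - q) / q + 1) := by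
    rw [ENNReal.rpow_add_of_nonneg _ _ hA hq0.le, ENNReal.rpow_add_of_nonneg _ _ h0 zero_le_one,
      ENNReal.rpow_one]
    ring
  rw [e, ENNReal.mul_rpow_of_nonneg _ _ (by positivity),
    ENNReal.mul_rpow_of_nonneg _ _ (by positivity), ← ENNReal.rpow_mul, ← ENNReal.rpow_mul,
    ← ENNReal.rpow_mul]
  have e1 : ((q - 1) * ((r - q) / q) + q) * (1 / r) = 1 - (1 / q - 1 / r) := by
    field_simp
    ring
  have e2 : (r - q) / q * (1 / r) = 1 / q - 1 / r := by
    field_simp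
  have e3 : ((r - q) / q + 1) * (1 / r) = 1 / q := by
    field_simp
    ring
  rw [e1, e2, e3]

theorem IsBddKernel.exists_enorm_le (hk : IsBddKernel k) : ∃ B : ℝ≥0∞, B ≠ ∞ ∧ ∀ z, ‖k z‖ₑ ≤ B := by
  obtain ⟨B, hB⟩ := hk.bdd
  exact ⟨ENNReal.ofReal B, ENNReal.ofReal_ne_top, fun z => by
    rw [Real.enorm_eq_ofReal_abs]; exact ENNReal.ofReal_le_ofReal (hB z)⟩

theorem absConv_lt_top (hk : IsBddKernel k) (hq : 1 ≤ q) (hw : MemLp w (ENNReal.ofReal q))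
    (x : Sp d) : absConv k w x < ∞ := by
  have hq0 : 0 < q := by linarith
  obtain ⟨B, hB, hkB⟩ := hk.exists_enorm_le
  have h := absConv_rpow_le_sup hk.measurable hw.1.aemeasurable hq hkB x
  have hW : ∫⁻ y, ‖w y‖ₑ ^ q < ∞ := by
    have := lintegral_rpow_enorm_lt_top_of_eLpNorm_lt_top (by simpa using hq0)
      ENNReal.ofReal_ne_top hw.2
    rwa [ENNReal.toReal_ofReal hq0.le] at this
  have h2 : (∫⁻ z, ‖k z‖ₑ) ^ (q - 1) * (B * ∫⁻ y, ‖w y‖ₑ ^ q) < ∞ :=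
    ENNReal.mul_lt_top (ENNReal.rpow_lt_top_of_nonneg (by linarith) hk.integrable.2.ne)
      (ENNReal.mul_lt_top hB.lt_top hW)
  exact (ENNReal.rpow_lt_top_iff_of_pos hq0).1 (h.trans_lt h2)

theorem integrable_convFun (hk : IsBddKernel k) (hq : 1 ≤ q) (hw : MemLp w (ENNReal.ofReal q))
    (x : Sp d) : Integrable fun y => k (x - y) * w y := by
  refine ⟨?_, ?_⟩
  · have h1 : Measurable fun y => k (x - y) := hk.measurable.comp (measurable_const.sub measurable_id)
    exact h1.aestronglyMeasurable.mul hw.1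
  · rw [hasFiniteIntegral_iff_enorm]
    simpa only [enorm_mul, absConv] using absConv_lt_top hk hq hw x

theorem enorm_convFun_le (x : Sp d) : ‖convFun k w x‖ₑ ≤ absConv k w x := by
  refine (enorm_integral_le_lintegral_enorm _).trans (le_of_eq ?_)
  simp only [enorm_mul]
  rfl

theorem aestronglyMeasurable_convFun (hk : Measurable k) (hw : AEStronglyMeasurable w) :
    AEStronglyMeasurable (convFun k w) := by
  have h1 : Measurable fun z : Sp d × Sp d => k (z.1 - z.2) := by fun_prop
  have : AEStronglyMeasurable (fun z : Sp d × Sp d => k (z.1 - z.2) * w z.2)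
      (volume.prod volume) :=
    h1.aestronglyMeasurable.mul hw.comp_snd
  exact this.integral_prod_right'

/-- Young's inequality, interpolated between the integral and the supremum of the kernel. -/
theorem eLpNorm_convFun_le (hk : Measurable k) (hw : AEStronglyMeasurable w) (hq : 1 ≤ q)
    (hqr : q ≤ r) {B : ℝ≥0∞} (hB : ∀ z, ‖k z‖ₑ ≤ B) :
    eLpNorm (convFun k w) (ENNReal.ofReal r) volume ≤ (∫⁻ z, ‖k z‖ₑ) ^ (1 - (1 / q - 1 / r)) *
      B ^ (1 / q - 1 / r) * eLpNorm w (ENNReal.ofReal q) volume := by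
  have hq0 : 0 < q := by linarith
  have hr0 : 0 < r := by linarith
  rw [eLpNorm_eq_lintegral_rpow_enorm_toReal (by simpa using hr0) ENNReal.ofReal_ne_top,
    eLpNorm_eq_lintegral_rpow_enorm_toReal (by simpa using hq0) ENNReal.ofReal_ne_top,
    ENNReal.toReal_ofReal hr0.le, ENNReal.toReal_ofReal hq0.le]
  refine le_trans ?_ (lintegral_absConv_rpow_le' hk hw.aemeasurable hq hqr hB)
  gcongr with x
  exact enorm_convFun_le x

theorem one_div_sub_nonneg (hq : 1 ≤ q) (hqr : q ≤ r) : 0 ≤ 1 / q - 1 / r := by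
  rw [sub_nonneg]; exact one_div_le_one_div_of_le (by linarith) hqr

theorem one_sub_one_div_sub_pos (hq : 1 ≤ q) (hqr : q ≤ r) : 0 < 1 - (1 / q - 1 / r) := by
  have h1 : 1 / q ≤ 1 := by rw [div_le_one (by linarith)]; exact hq
  have h2 : 0 < 1 / r := by have : 0 < r := by linarith
                            positivity
  linarith

theorem memLp_convFun (hk : IsBddKernel k) (hw : MemLp w (ENNReal.ofReal q)) (hq : 1 ≤ q)
    (hqr : q ≤ r) : MemLp (convFun k w) (ENNReal.ofReal r) := by
  obtain ⟨B, hB, hkB⟩ := hk.exists_enorm_le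
  refine ⟨aestronglyMeasurable_convFun hk.measurable hw.1,
    (eLpNorm_convFun_le hk.measurable hw.1 hq hqr hkB).trans_lt ?_⟩
  exact ENNReal.mul_lt_top (ENNReal.mul_lt_top
    (ENNReal.rpow_lt_top_of_nonneg (one_sub_one_div_sub_pos hq hqr).le hk.integrable.2.ne)
    (ENNReal.rpow_lt_top_of_nonneg (one_div_sub_nonneg hq hqr) hB)) hw.2

theorem convFun_congr_ae {w' : Sp d → ℝ} (h : w =ᵐ[volume] w') (x : Sp d) :
    convFun k w x = convFun k w' x :=
  integral_congr_ae (h.mono fun y hy => by simp only [hy])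

theorem norm_toLp_convFun_le (hk : IsBddKernel k) (hq : 1 ≤ q) (hqr : q ≤ r) {B : ℝ}
    (hB : ∀ z, |k z| ≤ B) (v : Lp ℝ (ENNReal.ofReal q) (volume : Measure (Sp d))) :
    ‖(memLp_convFun hk (Lp.memLp v) hq hqr).toLp‖ ≤
      (∫ z, |k z|) ^ (1 - (1 / q - 1 / r)) * B ^ (1 / q - 1 / r) * ‖v‖ := by
  have hB0 : 0 ≤ B := (abs_nonneg _).trans (hB 0)
  have h := eLpNorm_convFun_le (r := r) hk.measurable (Lp.aestronglyMeasurable v) hq hqr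
    (B := ENNReal.ofReal B) (fun z => by
      rw [Real.enorm_eq_ofReal_abs]; exact ENNReal.ofReal_le_ofReal (hB z))
  rw [Lp.norm_toLp, Lp.norm_def]
  have e1 : ∫ z, |k z| = (∫⁻ z, ‖k z‖ₑ).toReal := by
    rw [← integral_norm_eq_lintegral_enorm hk.integrable.1]; rfl
  have e2 : (∫ z, |k z|) ^ (1 - (1 / q - 1 / r)) * B ^ (1 / q - 1 / r) *
      (eLpNorm v (ENNReal.ofReal q) volume).toReal =
      ((∫⁻ z, ‖k z‖ₑ) ^ (1 - (1 / q - 1 / r)) * ENNReal.ofReal B ^ (1 / q - 1 / r) *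
        eLpNorm v (ENNReal.ofReal q) volume).toReal := by
    rw [ENNReal.toReal_mul, ENNReal.toReal_mul, ← ENNReal.toReal_rpow, ← ENNReal.toReal_rpow, e1,
      ENNReal.toReal_ofReal hB0]
  rw [e2]
  refine ENNReal.toReal_mono ?_ h
  exact (ENNReal.mul_lt_top (ENNReal.mul_lt_top
    (ENNReal.rpow_lt_top_of_nonneg (one_sub_one_div_sub_pos hq hqr).le hk.integrable.2.ne)
    (ENNReal.rpow_lt_top_of_nonneg (one_div_sub_nonneg hq hqr) ENNReal.ofReal_ne_top))
      (Lp.memLp v).2).ne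

open Classical in
/-- Convolution with a bounded integrable kernel as an operator from `L^q` to `L^r`. -/
def convLp (q r : ℝ) [hq : Fact (1 ≤ ENNReal.ofReal q)] [hr : Fact (1 ≤ ENNReal.ofReal r)]
    (k : Sp d → ℝ) : Lp ℝ (ENNReal.ofReal q) (volume : Measure (Sp d)) →L[ℝ]
      Lp ℝ (ENNReal.ofReal r) (volume : Measure (Sp d)) :=
  -- The default value 0 makes the operator total in k, so a time-dependent family can be written
  -- without carrying proofs; the estimates use only positive times.
  if h : IsBddKernel k ∧ q ≤ r then
    LinearMap.mkContinuous
      { toFun := fun v =>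
          (memLp_convFun h.1 (Lp.memLp v) (ENNReal.one_le_ofReal.1 hq.out) h.2).toLp
        map_add' := fun v w => by
          rw [← MemLp.toLp_add, MemLp.toLp_eq_toLp_iff]
          refine Filter.Eventually.of_forall fun x => ?_
          rw [convFun_congr_ae (Lp.coeFn_add v w), Pi.add_apply, convFun, convFun, convFun,
            ← integral_add
              (integrable_convFun h.1 (ENNReal.one_le_ofReal.1 hq.out) (Lp.memLp v) x)
              (integrable_convFun h.1 (ENNReal.one_le_ofReal.1 hq.out) (Lp.memLp w) x)]
          simp [mul_add]
        map_smul' := fun c v => by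
          rw [RingHom.id_apply, ← MemLp.toLp_const_smul, MemLp.toLp_eq_toLp_iff]
          refine Filter.Eventually.of_forall fun x => ?_
          rw [convFun_congr_ae (Lp.coeFn_smul c v), Pi.smul_apply, convFun, convFun,
            smul_eq_mul, ← integral_const_mul]
          simp [mul_left_comm] }
      ((∫ z, |k z|) ^ (1 - (1 / q - 1 / r)) * h.1.bdd.choose ^ (1 / q - 1 / r))
      fun v => norm_toLp_convFun_le h.1 (ENNReal.one_le_ofReal.1 hq.out) h.2
        h.1.bdd.choose_spec v
  else 0

variable [hq : Fact (1 ≤ ENNReal.ofReal q)] [hr : Fact (1 ≤ ENNReal.ofReal r)]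

theorem convLp_apply (hk : IsBddKernel k) (hqr : q ≤ r)
    (v : Lp ℝ (ENNReal.ofReal q) (volume : Measure (Sp d))) :
    convLp q r k v =
      (memLp_convFun hk (Lp.memLp v) (ENNReal.one_le_ofReal.1 hq.out) hqr).toLp := by
  rw [convLp, dif_pos ⟨hk, hqr⟩]
  rfl

theorem coeFn_convLp (hk : IsBddKernel k) (hqr : q ≤ r)
    (v : Lp ℝ (ENNReal.ofReal q) (volume : Measure (Sp d))) :
    convLp q r k v =ᵐ[volume] convFun k v := by
  rw [convLp_apply hk hqr]
  exact MemLp.coeFn_toLp _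

/-- The construction of `convLp` uses an arbitrarily chosen sup bound; any explicit bound B may
replace it here, which is what gives the power of t. -/
theorem norm_convLp_le (hk : IsBddKernel k) (hqr : q ≤ r) {B : ℝ} (hB : ∀ z, |k z| ≤ B) :
    ‖convLp q r k‖ ≤ (∫ z, |k z|) ^ (1 - (1 / q - 1 / r)) * B ^ (1 / q - 1 / r) := by
  have hB0 : 0 ≤ B := (abs_nonneg _).trans (hB 0)
  refine ContinuousLinearMap.opNorm_le_bound _ (mul_nonneg
    (Real.rpow_nonneg (integral_nonneg fun _ => abs_nonneg _) _) (Real.rpow_nonneg hB0 _)) fun v => ?_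
  rw [convLp_apply hk hqr]
  exact norm_toLp_convFun_le hk (ENNReal.one_le_ofReal.1 hq.out) hqr hB v

theorem convLp_sub {k' : Sp d → ℝ} (hk : IsBddKernel k) (hk' : IsBddKernel k') (hqr : q ≤ r) :
    convLp q r (k - k') = convLp q r k - convLp q r k' := by
  have hq1 := ENNReal.one_le_ofReal.1 hq.out
  ext1 v
  rw [sub_apply, convLp_apply (hk.sub hk') hqr, convLp_apply hk hqr,
    convLp_apply hk' hqr, ← MemLp.toLp_sub, MemLp.toLp_eq_toLp_iff]
  refine Filter.Eventually.of_forall fun x => ?_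
  rw [Pi.sub_apply, convFun, convFun, convFun, ← integral_sub
    (integrable_convFun hk hq1 (Lp.memLp v) x) (integrable_convFun hk' hq1 (Lp.memLp v) x)]
  simp [sub_mul]

end Young

end

/-! ### The kernel and its gradient as superpositions of complex Gaussians. -/

noncomputable section

section Kernel

open Complex Filter Topology

variable {d : ℕ}

/-- A complex Gaussian in `z`; its integral over `l` is a multiple of the L-KS kernel at time
`s ^ 2`. -/
def gaussMix (s : ℝ) (z : Sp d) (l : ℝ) : ℂ :=
  cexp (-2 * l ^ 2 + 2 + 2 * s - (4 * l + 2 * l * s) * I) *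
    (Real.pi / (s * (1 - l * I))) ^ (d / 2 : ℂ) * cexp (-‖z‖ ^ 2 / (4 * (s * (1 - l * I))))

/-- The directional derivative of `gaussMix` in the direction `-e`. -/
def gaussMixDeriv (e : Sp d) (s : ℝ) (z : Sp d) (l : ℝ) : ℂ :=
  gaussMix s z l * (inner ℝ z e / (2 * (s * (1 - l * I))))

/-- The Fourier integrand of the L-KS kernel at time `s ^ 2` as a superposition of Gaussians. -/
def fourierMix (s : ℝ) (z : Sp d) (ξ : Sp d) (l : ℝ) : ℂ :=
  cexp (-2 * l ^ 2 + (s * (-2 + ‖ξ‖ ^ 2) - 4) * I * l + (2 - s * (-2 + ‖ξ‖ ^ 2) + I * inner ℝ z ξ))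

/-- Put A = -2 + |ξ|². The Gaussian integral in l produces -(sA - 4)²/8 = -s²A²/8 + sA - 2, and the
added terms 2 - sA leave exactly the symbol at time s². -/
theorem integral_fourierMix (s : ℝ) (z ξ : Sp d) :
    ∫ l, fourierMix s z ξ l = (Real.pi / 2 : ℂ) ^ (1 / 2 : ℂ) *
      (cexp (-(s ^ 2 / 8) * (-2 + ‖ξ‖ ^ 2) ^ 2) * cexp (I * inner ℝ z ξ)) := by
  unfold fourierMix
  rw [integral_cexp_quadratic (by norm_num), ← Complex.exp_add, neg_neg]
  congr 2
  ring_nf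
  simp only [I_sq]
  ring

/-- The shift by 4 in the linear term pays off here: the compensating real factor e^{2 - sA}
contains e^{-s|ξ|²}, so the integrand is absolutely integrable in (ξ, l) and Fubini applies. -/
theorem norm_fourierMix (s : ℝ) (z ξ : Sp d) (l : ℝ) :
    ‖fourierMix s z ξ l‖ =
      (Real.exp (2 + 2 * s) * Real.exp (-s * ‖ξ‖ ^ 2)) * Real.exp (-2 * l ^ 2) := by
  rw [fourierMix, norm_exp, ← Real.exp_add, ← Real.exp_add]
  congr 1
  simp [pow_two]
  ring

theorem integrable_exp_neg_mul_sq_norm {s : ℝ} (hs : 0 < s) :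
    Integrable fun ξ : Sp d => Real.exp (-s * ‖ξ‖ ^ 2) := by
  have h := (GaussianFourier.integrable_cexp_neg_mul_sq_norm_add (V := Sp d) (b := s)
    (by simpa using hs) 0 0).norm
  refine h.congr (Eventually.of_forall fun ξ => ?_)
  simp [norm_exp, pow_two]

theorem integrable_fourierMix {s : ℝ} (hs : 0 < s) (z : Sp d) :
    Integrable (Function.uncurry (fourierMix s z)) (volume.prod volume) := by
  have h1 : Integrable fun ξ : Sp d => Real.exp (2 + 2 * s) * Real.exp (-s * ‖ξ‖ ^ 2) :=
    (integrable_exp_neg_mul_sq_norm hs).const_mul _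
  have h2 : Integrable fun l : ℝ => Real.exp (-2 * l ^ 2) := integrable_exp_neg_mul_sq (by norm_num)
  refine (h1.mul_prod h2).mono' ?_ (Eventually.of_forall fun p => (norm_fourierMix s z p.1 p.2).le)
  refine Continuous.aestronglyMeasurable ?_
  unfold Function.uncurry fourierMix
  fun_prop

theorem re_mul_one_sub {s : ℝ} (l : ℝ) : ((s : ℂ) * (1 - l * I)).re = s := by simp

theorem integral_fourierMix_left {s : ℝ} (hs : 0 < s) (z : Sp d) (l : ℝ) :
    ∫ ξ, fourierMix s z ξ l = gaussMix s z l := by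
  have h := GaussianFourier.integral_cexp_neg_mul_sq_norm_add (V := Sp d)
    (b := s * (1 - l * I)) (by rw [re_mul_one_sub]; exact hs) I z
  have e : ∀ ξ : Sp d, fourierMix s z ξ l =
      cexp (-2 * l ^ 2 + 2 + 2 * s - (4 * l + 2 * l * s) * I) *
        cexp (-(s * (1 - l * I)) * ‖ξ‖ ^ 2 + I * inner ℝ z ξ) := by
    intro ξ
    rw [fourierMix, ← Complex.exp_add]
    congr 1
    ring
  simp_rw [e]
  rw [integral_const_mul, h, gaussMix, finrank_euclideanSpace_fin, I_sq]
  ring_nf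

theorem integral_gaussMix {s : ℝ} (hs : 0 < s) (z : Sp d) :
    ∫ l, gaussMix s z l = (Real.pi / 2 : ℂ) ^ (1 / 2 : ℂ) *
      ∫ ξ : Sp d, cexp (-(s ^ 2 / 8) * (-2 + ‖ξ‖ ^ 2) ^ 2) * cexp (I * inner ℝ z ξ) := by
  simp_rw [← integral_fourierMix_left hs z]
  rw [← integral_integral_swap (integrable_fourierMix hs z)]
  simp_rw [integral_fourierMix]
  rw [integral_const_mul]

theorem pi_div_two_cpow_ne_zero : (Real.pi / 2 : ℂ) ^ (1 / 2 : ℂ) ≠ 0 := by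
  have h : (Real.pi / 2 : ℂ) ≠ 0 := by simp [Real.pi_ne_zero]
  rw [Ne, Complex.cpow_eq_zero_iff]
  simp [h]

/-- Up to a nonzero constant the symbol is the l-marginal of an integrable function on the product.
-/
theorem integrable_symbol {s : ℝ} (hs : 0 < s) (z : Sp d) :
    Integrable fun ξ : Sp d =>
      cexp (-(s ^ 2 / 8) * (-2 + ‖ξ‖ ^ 2) ^ 2) * cexp (I * inner ℝ z ξ) := by
  have h := (integrable_fourierMix hs z).integral_prod_left
  simp only [Function.uncurry, integral_fourierMix] at h
  have h2 := h.const_mul ((Real.pi / 2 : ℂ) ^ (1 / 2 : ℂ))⁻¹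
  simpa only [inv_mul_cancel_left₀ pi_div_two_cpow_ne_zero] using h2

/-- The normalized integral of a family of complex functions over the mixing variable. -/
def mixIntegral (M : ℝ → Sp d → ℝ → ℂ) (t : ℝ) (z : Sp d) : ℝ :=
  ((2 * Real.pi) ^ d)⁻¹ * (((Real.pi / 2 : ℂ) ^ (1 / 2 : ℂ))⁻¹ * ∫ l, M (√t) z l).re

theorem lksKernel_eq_integral_re {t : ℝ} (x y : Sp d) :
    lksKernel t x y = ((2 * Real.pi) ^ d)⁻¹ * ∫ ξ : Sp d,
      (cexp (-(t / 8) * (-2 + ‖ξ‖ ^ 2) ^ 2) * cexp (I * inner ℝ (x - y) ξ)).re := by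
  rw [lksKernel]
  congr 2
  ext ξ
  have e1 : cexp (-(t / 8) * (-2 + ‖ξ‖ ^ 2) ^ 2) =
      (Real.exp (-(t / 8) * (-2 + ‖ξ‖ ^ 2) ^ 2) : ℝ) := by
    push_cast
    rfl
  rw [e1, re_ofReal_mul, real_inner_comm, mul_comm I, exp_ofReal_mul_I_re]

theorem lksKernel_eq_mixIntegral {t : ℝ} (ht : 0 < t) (x y : Sp d) :
    lksKernel t x y = mixIntegral gaussMix t (x - y) := by
  have hs : 0 < √t := Real.sqrt_pos.2 ht
  have e : ((√t : ℝ) : ℂ) ^ 2 = t := by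
    rw [← ofReal_pow, Real.sq_sqrt ht.le]
  rw [mixIntegral, integral_gaussMix hs, inv_mul_cancel_left₀ pi_div_two_cpow_ne_zero,
    lksKernel_eq_integral_re]
  congr 1
  have h := integrable_symbol hs (x - y)
  rw [e] at h ⊢
  exact (integral_re h)

section Bounds

theorem one_sub_mul_I_ne_zero (l : ℝ) : (1 - l * I : ℂ) ≠ 0 := by
  intro h
  simpa using congrArg re h

theorem re_inv_one_sub {s : ℝ} (hs : 0 < s) (a l : ℝ) :
    (-(a : ℂ) ^ 2 / (4 * (s * (1 - l * I)))).re = -(a ^ 2 / (4 * s * (1 + l ^ 2))) := by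
  have h1 : (1 + l ^ 2 : ℂ) ≠ 0 := by
    have : (1 + l ^ 2 : ℝ) ≠ 0 := by positivity
    exact_mod_cast this
  have h0 : (s : ℂ) ≠ 0 := by exact_mod_cast hs.ne'
  have e : -(a : ℂ) ^ 2 / (4 * (s * (1 - l * I))) =
      ((-(a ^ 2 / (4 * s * (1 + l ^ 2))) : ℝ) : ℂ) * (1 + l * I) := by
    have := one_sub_mul_I_ne_zero l
    push_cast
    field_simp
    ring_nf
    simp only [I_sq]
    ring
  rw [e, re_ofReal_mul]
  simp

theorem one_le_norm_one_sub (l : ℝ) : 1 ≤ ‖(1 - l * I : ℂ)‖ := by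
  have := abs_re_le_norm (1 - l * I : ℂ)
  simpa using this

theorem norm_one_sub_sq (l : ℝ) : ‖(1 - l * I : ℂ)‖ ^ 2 = 1 + l ^ 2 := by
  rw [Complex.sq_norm, normSq_apply]
  simp
  ring

theorem norm_gaussMix_le {s : ℝ} (hs : 0 < s) (z : Sp d) (l : ℝ) :
    ‖gaussMix s z l‖ ≤ Real.exp (-2 * l ^ 2 + 2 + 2 * s) * (Real.pi / s) ^ (d / 2 : ℝ) *
      Real.exp (-(‖z‖ ^ 2 / (4 * s * (1 + l ^ 2)))) := by
  rw [gaussMix, norm_mul, norm_mul, norm_exp, norm_exp, re_inv_one_sub hs]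
  have e1 : (-2 * (l : ℂ) ^ 2 + 2 + 2 * s - (4 * l + 2 * l * s) * I).re =
      -2 * l ^ 2 + 2 + 2 * s := by
    simp [pow_two]
  have e2 : (d / 2 : ℂ) = ((d / 2 : ℝ) : ℂ) := by push_cast; rfl
  rw [e1, e2, norm_cpow_real]
  have hl := one_le_norm_one_sub l
  gcongr
  rw [norm_div, norm_mul, norm_real, norm_real, Real.norm_of_nonneg Real.pi_pos.le,
    Real.norm_of_nonneg hs.le]
  gcongr
  nlinarith

/-- AM-GM in the quantity 1 + l². It trades part of the decay in l for exponential decay in |z| at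
scale ρ = √s = t^{1/4}, uniformly in l. -/
theorem gaussian_exponent_le {ρ : ℝ} (hρ : 0 < ρ) (a l : ℝ) :
    a / (2 * ρ) ≤ 1 + l ^ 2 + a ^ 2 / (8 * ρ ^ 2 * (1 + l ^ 2)) := by
  have hu : 0 < 1 + l ^ 2 := by positivity
  have : 1 + l ^ 2 + a ^ 2 / (8 * ρ ^ 2 * (1 + l ^ 2)) - a / (2 * ρ) =
      ((a / ρ - 2 * (1 + l ^ 2)) ^ 2 + 4 * (1 + l ^ 2) ^ 2) / (8 * (1 + l ^ 2)) := by
    field_simp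
    ring
  have h2 : 0 ≤ ((a / ρ - 2 * (1 + l ^ 2)) ^ 2 + 4 * (1 + l ^ 2) ^ 2) / (8 * (1 + l ^ 2)) := by
    positivity
  linarith

theorem exp_mul_exp_le {s : ℝ} (hs : 0 < s) (a l : ℝ) :
    Real.exp (-2 * l ^ 2 + 2 + 2 * s) * Real.exp (-(a ^ 2 / (8 * s * (1 + l ^ 2)))) ≤
      Real.exp (3 + 2 * s) * Real.exp (-l ^ 2) * Real.exp (-(a / (2 * √s))) := by
  have h := gaussian_exponent_le (Real.sqrt_pos.2 hs) a l
  rw [Real.sq_sqrt hs.le] at h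
  rw [← Real.exp_add, ← Real.exp_add, ← Real.exp_add]
  exact Real.exp_le_exp.2 (by linarith)

theorem norm_gaussMix_le_exp {s : ℝ} (hs : 0 < s) (z : Sp d) (l : ℝ) :
    ‖gaussMix s z l‖ ≤ Real.exp (3 + 2 * s) * (Real.pi / s) ^ (d / 2 : ℝ) * Real.exp (-l ^ 2) *
      Real.exp (-(‖z‖ / (2 * √s))) := by
  have hl : 0 < 1 + l ^ 2 := by positivity
  have h1 : Real.exp (-(‖z‖ ^ 2 / (4 * s * (1 + l ^ 2)))) ≤
      Real.exp (-(‖z‖ ^ 2 / (8 * s * (1 + l ^ 2)))) := by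
    gcongr
    norm_num
  calc _ ≤ _ := norm_gaussMix_le hs z l
    _ ≤ (Real.pi / s) ^ (d / 2 : ℝ) * (Real.exp (-2 * l ^ 2 + 2 + 2 * s) *
        Real.exp (-(‖z‖ ^ 2 / (8 * s * (1 + l ^ 2))))) := by
      rw [mul_comm (Real.exp _) (_ ^ _), mul_assoc]
      have : 0 ≤ (Real.pi / s) ^ (d / 2 : ℝ) := by positivity
      gcongr
    _ ≤ (Real.pi / s) ^ (d / 2 : ℝ) * _ :=
      mul_le_mul_of_nonneg_left (exp_mul_exp_le hs ‖z‖ l) (by positivity)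
    _ = _ := by ring

/-- Half of the Gaussian decay absorbs the linear factor created by differentiation. -/
theorem half_mul_exp_neg_sq_le (v : ℝ) :
    v / 2 * Real.exp (-(v ^ 2 / 4)) ≤ Real.exp (-(v ^ 2 / 8)) := by
  have h1 : v / 2 ≤ Real.exp (v ^ 2 / 8) := by
    have := Real.add_one_le_exp (v ^ 2 / 8)
    nlinarith [sq_nonneg (v - 2)]
  calc _ ≤ Real.exp (v ^ 2 / 8) * Real.exp (-(v ^ 2 / 4)) := by gcongr
    _ = _ := by rw [← Real.exp_add]; congr 1; ring

theorem norm_gaussMixDeriv_le {s : ℝ} (hs : 0 < s) {e : Sp d} (he : ‖e‖ ≤ 1) (z : Sp d) (l : ℝ) :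
    ‖gaussMixDeriv e s z l‖ ≤ Real.exp (3 + 2 * s) * (Real.pi / s) ^ (d / 2 : ℝ) * (√s)⁻¹ *
      Real.exp (-l ^ 2) * Real.exp (-(‖z‖ / (2 * √s))) := by
  set ρ := √s with hρ
  have hρ0 : 0 < ρ := Real.sqrt_pos.2 hs
  have hs2 : s = ρ ^ 2 := (Real.sq_sqrt hs.le).symm
  set n := ‖(1 - l * I : ℂ)‖ with hn
  have hn0 : 0 < n := by linarith [one_le_norm_one_sub l]
  have hn2 : 1 + l ^ 2 = n ^ 2 := (norm_one_sub_sq l).symm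
  -- In terms of v = |z|/(ρ n), the derivative costs ρ⁻¹ · v/2, while the Gaussian is e^{-v²/4}. The
  -- surviving ρ⁻¹ = t^{-1/4} is the parabolic price of one derivative.
  have h1 : ‖(inner ℝ z e / (2 * (s * (1 - l * I))) : ℂ)‖ ≤ ρ⁻¹ * (‖z‖ / (ρ * n) / 2) := by
    rw [norm_div, norm_mul, norm_mul, norm_real, norm_real, ← hn, Real.norm_of_nonneg hs.le]
    have h2 : ‖inner ℝ z e‖ ≤ ‖z‖ :=
      (norm_inner_le_norm z e).trans (mul_le_of_le_one_right (norm_nonneg _) he)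
    calc _ ≤ ‖z‖ / (‖(2 : ℂ)‖ * (s * n)) := by gcongr
      _ = _ := by
        rw [hs2, Complex.norm_ofNat]
        field_simp
  have h3 := half_mul_exp_neg_sq_le (‖z‖ / (ρ * n))
  have e1 : (‖z‖ / (ρ * n)) ^ 2 / 4 = ‖z‖ ^ 2 / (4 * s * (1 + l ^ 2)) := by
    rw [hs2, hn2]; field_simp
  have e2 : (‖z‖ / (ρ * n)) ^ 2 / 8 = ‖z‖ ^ 2 / (8 * s * (1 + l ^ 2)) := by
    rw [hs2, hn2]; field_simp
  rw [e1, e2] at h3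
  rw [gaussMixDeriv, norm_mul]
  calc _ ≤ (Real.exp (-2 * l ^ 2 + 2 + 2 * s) * (Real.pi / s) ^ (d / 2 : ℝ) *
        Real.exp (-(‖z‖ ^ 2 / (4 * s * (1 + l ^ 2))))) * (ρ⁻¹ * (‖z‖ / (ρ * n) / 2)) := by
        gcongr
        exact norm_gaussMix_le hs z l
    _ = (Real.pi / s) ^ (d / 2 : ℝ) * ρ⁻¹ * (Real.exp (-2 * l ^ 2 + 2 + 2 * s) *
        (‖z‖ / (ρ * n) / 2 * Real.exp (-(‖z‖ ^ 2 / (4 * s * (1 + l ^ 2)))))) := by ring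
    _ ≤ (Real.pi / s) ^ (d / 2 : ℝ) * ρ⁻¹ * (Real.exp (-2 * l ^ 2 + 2 + 2 * s) *
        Real.exp (-(‖z‖ ^ 2 / (8 * s * (1 + l ^ 2))))) := by gcongr
    _ ≤ (Real.pi / s) ^ (d / 2 : ℝ) * ρ⁻¹ * _ :=
        mul_le_mul_of_nonneg_left (exp_mul_exp_le hs ‖z‖ l) (by positivity)
    _ = _ := by ring

theorem mul_one_sub_ne_zero {s : ℝ} (hs : 0 < s) (l : ℝ) : (s * (1 - l * I) : ℂ) ≠ 0 :=
  mul_ne_zero (by exact_mod_cast hs.ne') (one_sub_mul_I_ne_zero l)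

theorem continuousAt_gaussMix {s : ℝ} (hs : 0 < s) (z : Sp d) (l : ℝ) :
    ContinuousAt (fun q : ℝ × Sp d × ℝ => gaussMix q.1 q.2.1 q.2.2) (s, z, l) := by
  have hb := mul_one_sub_ne_zero hs l
  unfold gaussMix
  refine ContinuousAt.mul (ContinuousAt.mul (by fun_prop) ?_) ?_
  · refine ContinuousAt.cpow (ContinuousAt.div (by fun_prop) (by fun_prop) hb) (by fun_prop) ?_
    left
    simp only [Complex.div_re, ofReal_re, ofReal_im, re_mul_one_sub]
    have : 0 < normSq (s * (1 - l * I)) := normSq_pos.2 hb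
    simp only [zero_mul, zero_div, add_zero]
    have := Real.pi_pos
    positivity
  · refine Continuous.continuousAt (by fun_prop) |>.comp
      (ContinuousAt.div (by fun_prop) (by fun_prop) ?_)
    exact mul_ne_zero (by norm_num) hb

theorem continuousAt_gaussMixDeriv (e : Sp d) {s : ℝ} (hs : 0 < s) (z : Sp d) (l : ℝ) :
    ContinuousAt (fun q : ℝ × Sp d × ℝ => gaussMixDeriv e q.1 q.2.1 q.2.2) (s, z, l) := by
  unfold gaussMixDeriv
  refine (continuousAt_gaussMix hs z l).mul (ContinuousAt.div (by fun_prop) (by fun_prop) ?_)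
  exact mul_ne_zero (by norm_num) (mul_one_sub_ne_zero hs l)

end Bounds

end Kernel

end

/-! ### Parabolic bounds for the kernel and its gradient; the mass of the kernel. -/

noncomputable section

section KernelBounds

open Complex Filter Topology

variable {d : ℕ}

/-- Families of kernels with the scaling and decay of a fourth order parabolic kernel of
singularity `t ^ (-β)` in the integral norm. -/
structure IsParabolicKernel (k : ℝ → Sp d → ℝ) (β : ℝ) : Prop where
  continuousOn : ContinuousOn (Function.uncurry k) (Ioi 0 ×ˢ univ)
  bound : ∃ C : ℝ, 0 ≤ C ∧ ∀ t, 0 < t → ∀ z, |k t z| ≤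
    C * Real.exp (2 * √t) * t ^ (-(β + d / 4)) * Real.exp (-(‖z‖ / (2 * √√t)))

/-- Complex families over a mixing variable, with Gaussian decay in it. -/
structure IsMixFamily (M : ℝ → Sp d → ℝ → ℂ) (γ D : ℝ) : Prop where
  nonneg : 0 ≤ D
  continuousAt : ∀ s, 0 < s → ∀ z l,
    ContinuousAt (fun q : ℝ × Sp d × ℝ => M q.1 q.2.1 q.2.2) (s, z, l)
  bound : ∀ s, 0 < s → ∀ z l, ‖M s z l‖ ≤
    D * Real.exp (2 * s) * s ^ (-γ) * Real.exp (-l ^ 2) * Real.exp (-(‖z‖ / (2 * √s)))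

theorem pi_div_rpow {s : ℝ} (hs : 0 < s) (a : ℝ) :
    (Real.pi / s) ^ a = Real.pi ^ a * s ^ (-a) := by
  rw [Real.div_rpow Real.pi_pos.le hs.le, Real.rpow_neg hs.le]
  rfl

theorem isMixFamily_gaussMix :
    IsMixFamily (d := d) gaussMix (d / 2) (Real.exp 3 * Real.pi ^ (d / 2 : ℝ)) where
  nonneg := by positivity
  continuousAt s hs z l := continuousAt_gaussMix hs z l
  bound s hs z l := by
    refine (norm_gaussMix_le_exp hs z l).trans (le_of_eq ?_)
    rw [pi_div_rpow hs, Real.exp_add]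
    ring

theorem isMixFamily_gaussMixDeriv {e : Sp d} (he : ‖e‖ ≤ 1) :
    IsMixFamily (gaussMixDeriv e) (d / 2 + 1 / 2) (Real.exp 3 * Real.pi ^ (d / 2 : ℝ)) where
  nonneg := by positivity
  continuousAt s hs z l := continuousAt_gaussMixDeriv e hs z l
  bound s hs z l := by
    refine (norm_gaussMixDeriv_le hs he z l).trans (le_of_eq ?_)
    rw [pi_div_rpow hs, Real.exp_add, neg_add, Real.rpow_add hs, Real.rpow_neg hs.le (1 / 2),
      ← Real.sqrt_eq_rpow]
    ring

theorem integrable_exp_neg_sq : Integrable fun l : ℝ => Real.exp (-l ^ 2) := by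
  simpa using integrable_exp_neg_mul_sq (b := 1) one_pos

namespace IsMixFamily

variable {M : ℝ → Sp d → ℝ → ℂ} {γ D : ℝ}

theorem aestronglyMeasurable (h : IsMixFamily M γ D) {s : ℝ} (hs : 0 < s) (z : Sp d) :
    AEStronglyMeasurable (M s z) := by
  refine Continuous.aestronglyMeasurable (continuous_iff_continuousAt.2 fun l => ?_)
  have hc : ContinuousAt (fun l : ℝ => (s, z, l)) l := by fun_prop
  exact ContinuousAt.comp (f := fun l : ℝ => (s, z, l)) (h.continuousAt s hs z l) hc

theorem integrable (h : IsMixFamily M γ D) {s : ℝ} (hs : 0 < s) (z : Sp d) :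
    Integrable (M s z) :=
  ((integrable_exp_neg_sq.const_mul _).mul_const _).mono' (h.aestronglyMeasurable hs z)
    (Eventually.of_forall fun l => h.bound s hs z l)

theorem norm_integral_le (h : IsMixFamily M γ D) {s : ℝ} (hs : 0 < s) (z : Sp d) :
    ‖∫ l, M s z l‖ ≤ (D * ∫ l : ℝ, Real.exp (-l ^ 2)) * Real.exp (2 * s) * s ^ (-γ) *
      Real.exp (-(‖z‖ / (2 * √s))) := by
  refine (norm_integral_le_of_norm_le ((integrable_exp_neg_sq.const_mul _).mul_const _)
    (Eventually.of_forall fun l => h.bound s hs z l)).trans (le_of_eq ?_)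
  rw [integral_mul_const, integral_const_mul]
  ring

theorem continuousAt_integral (h : IsMixFamily M γ D) {s : ℝ} (hs : 0 < s) (z : Sp d) :
    ContinuousAt (fun q : ℝ × Sp d => ∫ l, M q.1 q.2 l) (s, z) := by
  have hpos : ∀ᶠ q : ℝ × Sp d in 𝓝 (s, z), 0 < q.1 :=
    continuous_fst.continuousAt.eventually (lt_mem_nhds hs)
  have hcont : ContinuousAt (fun q : ℝ × Sp d => D * Real.exp (2 * q.1) * q.1 ^ (-γ)) (s, z) :=
    ContinuousAt.mul (by fun_prop) (ContinuousAt.rpow_const (by fun_prop) (Or.inl hs.ne'))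
  have hbd := hcont.eventually (gt_mem_nhds (lt_add_one _))
  refine continuousAt_of_dominated
    (bound := fun l => (D * Real.exp (2 * s) * s ^ (-γ) + 1) * Real.exp (-l ^ 2)) ?_ ?_ ?_ ?_
  · filter_upwards [hpos] with q hq using h.aestronglyMeasurable hq _
  · filter_upwards [hpos, hbd] with q hq hqb
    refine Eventually.of_forall fun l => (h.bound q.1 hq q.2 l).trans ?_
    have hD := h.nonneg
    have h1 : Real.exp (-(‖q.2‖ / (2 * √q.1))) ≤ 1 := Real.exp_le_one_iff.2 (by
      rw [neg_nonpos]; positivity)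
    refine (mul_le_of_le_one_right (by positivity) h1).trans ?_
    gcongr
  · exact integrable_exp_neg_sq.const_mul _
  · refine Eventually.of_forall fun l => ?_
    have hc : ContinuousAt (fun q : ℝ × Sp d => (q.1, q.2, l)) (s, z) := by fun_prop
    exact ContinuousAt.comp (f := fun q : ℝ × Sp d => (q.1, q.2, l)) (h.continuousAt s hs z l) hc

/-- The relation between γ and β is the substitution s = √t, which turns s^{-γ} into t^{-(β + d/4)}.
-/
theorem isParabolicKernel {β : ℝ} (h : IsMixFamily M γ D) (hγ : γ = 2 * β + d / 2) :
    IsParabolicKernel (mixIntegral M) β where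
  continuousOn := by
    rintro ⟨t, z⟩ ⟨ht, -⟩
    refine ContinuousAt.continuousWithinAt ?_
    have hc : ContinuousAt (fun q : ℝ × Sp d => (√q.1, q.2)) (t, z) := by fun_prop
    have h1 := ContinuousAt.comp (f := fun q : ℝ × Sp d => (√q.1, q.2))
      (h.continuousAt_integral (Real.sqrt_pos.2 ht) z) hc
    unfold Function.uncurry mixIntegral
    exact continuousAt_const.mul (continuous_re.continuousAt.comp (continuousAt_const.mul h1))
  bound := by
    refine ⟨((2 * Real.pi) ^ d)⁻¹ * (‖((Real.pi / 2 : ℂ) ^ (1 / 2 : ℂ))⁻¹‖ *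
      (D * ∫ l : ℝ, Real.exp (-l ^ 2))), ?_, fun t ht z => ?_⟩
    · have := h.nonneg
      have : 0 ≤ ∫ l : ℝ, Real.exp (-l ^ 2) := integral_nonneg fun _ => Real.exp_nonneg _
      have := Real.pi_pos
      positivity
    · have h1 := h.norm_integral_le (Real.sqrt_pos.2 ht) z
      have e : (√t) ^ (-γ) = t ^ (-(β + d / 4)) := by
        rw [Real.sqrt_eq_rpow, ← Real.rpow_mul ht.le, hγ]
        congr 1
        ring
      rw [e] at h1
      have := Real.pi_pos
      rw [mixIntegral, abs_mul, abs_of_nonneg (by positivity : 0 ≤ ((2 * Real.pi) ^ d)⁻¹)]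
      have h2 := (abs_re_le_norm (((Real.pi / 2 : ℂ) ^ (1 / 2 : ℂ))⁻¹ * ∫ l, M (√t) z l)).trans
        ((norm_mul _ _).le.trans (mul_le_mul_of_nonneg_left h1 (norm_nonneg _)))
      refine (mul_le_mul_of_nonneg_left h2 (by positivity)).trans (le_of_eq ?_)
      ring

end IsMixFamily

theorem isParabolicKernel_gaussMix : IsParabolicKernel (d := d) (mixIntegral gaussMix) 0 :=
  isMixFamily_gaussMix.isParabolicKernel (by ring)

theorem isParabolicKernel_gaussMixDeriv {e : Sp d} (he : ‖e‖ ≤ 1) :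
    IsParabolicKernel (mixIntegral (gaussMixDeriv e)) (1 / 4) :=
  (isMixFamily_gaussMixDeriv he).isParabolicKernel (by ring)

theorem hasDerivAt_gaussMix {s : ℝ} (hs : 0 < s) (z e : Sp d) (l τ : ℝ) :
    HasDerivAt (fun τ : ℝ => gaussMix s (z - τ • e) l) (gaussMixDeriv e s (z - τ • e) l) τ := by
  have h1 : HasDerivAt (fun τ : ℝ => z - τ • e) (-e) τ := by
    simpa using ((hasDerivAt_id τ).smul_const e).const_sub z
  have h2 : HasDerivAt (fun τ : ℝ => (‖z - τ • e‖ ^ 2 : ℂ)) ((2 * inner ℝ (z - τ • e) (-e) : ℝ) : ℂ) τ := by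
    have := h1.norm_sq.ofReal_comp
    simpa using this
  have h3 := ((h2.neg.div_const (4 * (s * (1 - l * I)))).cexp).const_mul
    (cexp (-2 * l ^ 2 + 2 + 2 * s - (4 * l + 2 * l * s) * I) *
      (Real.pi / (s * (1 - l * I))) ^ (d / 2 : ℂ))
  refine h3.congr_deriv ?_
  have := mul_one_sub_ne_zero hs l
  rw [gaussMixDeriv, gaussMix]
  simp only [inner_neg_right]
  push_cast
  simp only [Pi.neg_apply]
  field_simp
  ring

/-- Dropping the spatial decay leaves a majorant in l that is uniform in the displacement, so
differentiation under the integral is dominated for all τ. -/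
theorem hasDerivAt_integral_gaussMix {s : ℝ} (hs : 0 < s) (z : Sp d) {e : Sp d} (he : ‖e‖ ≤ 1) :
    HasDerivAt (fun τ : ℝ => ∫ l, gaussMix s (z - τ • e) l) (∫ l, gaussMixDeriv e s z l) 0 := by
  have hM := isMixFamily_gaussMix (d := d)
  have hM' := isMixFamily_gaussMixDeriv he
  have h := hasDerivAt_integral_of_dominated_loc_of_deriv_le (μ := volume) (x₀ := (0 : ℝ))
    (F := fun τ l => gaussMix s (z - τ • e) l) (F' := fun τ l => gaussMixDeriv e s (z - τ • e) l)
    (s := univ) (bound := fun l => Real.exp 3 * Real.pi ^ (d / 2 : ℝ) * Real.exp (2 * s) *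
      s ^ (-(d / 2 + 1 / 2 : ℝ)) * Real.exp (-l ^ 2)) univ_mem
    (Eventually.of_forall fun τ => hM.aestronglyMeasurable hs _) (hM.integrable hs _)
    (hM'.aestronglyMeasurable hs _) ?_ (integrable_exp_neg_sq.const_mul _)
    (Eventually.of_forall fun l τ _ => hasDerivAt_gaussMix hs z e l τ)
  · simpa using h.2
  · refine Eventually.of_forall fun l τ _ => (hM'.bound s hs _ l).trans ?_
    refine mul_le_of_le_one_right (by positivity) (Real.exp_le_one_iff.2 ?_)
    rw [neg_nonpos]
    positivity

theorem lksKernelDeriv_eq_mixIntegral (j : Fin d) {t : ℝ} (ht : 0 < t) (x y : Sp d) :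
    lksKernelDeriv j t x y =
      mixIntegral (gaussMixDeriv (EuclideanSpace.single j (1 : ℝ))) t (x - y) := by
  have h := hasDerivAt_integral_gaussMix (Real.sqrt_pos.2 ht) (x - y)
    (e := EuclideanSpace.single j (1 : ℝ)) (by simp)
  have h2 := (reCLM.hasFDerivAt.comp_hasDerivAt (0 : ℝ)
    (h.const_mul (((Real.pi / 2 : ℂ) ^ (1 / 2 : ℂ))⁻¹))).const_mul (((2 * Real.pi) ^ d)⁻¹)
  rw [lksKernelDeriv, lineDeriv]
  refine HasDerivAt.deriv ?_
  refine (h2.congr_deriv rfl).congr_of_eventuallyEq (Eventually.of_forall fun τ => ?_)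
  simp only [lksKernel_eq_mixIntegral ht, mixIntegral, Function.comp, reCLM_apply, sub_add_eq_sub_sub]

/-- Comparison with (1 + |z|)^{-(d+1)}, using one term of the exponential series, then rescaling. -/
theorem integrable_exp_neg_norm_div {ρ : ℝ} (hρ : 0 < ρ) :
    Integrable fun z : Sp d => Real.exp (-(‖z‖ / ρ)) := by
  have h1 : Integrable fun z : Sp d => Real.exp (-‖z‖) := by
    have h : Integrable fun z : Sp d => (1 + ‖z‖) ^ (-((d : ℝ) + 1)) :=
      integrable_one_add_norm (by simp)
    refine (h.const_mul (((d + 1).factorial : ℝ) * Real.exp 1)).mono'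
      (by fun_prop) (Eventually.of_forall fun z => ?_)
    have h0 : 0 < 1 + ‖z‖ := by positivity
    have h2 := Real.pow_div_factorial_le_exp (1 + ‖z‖) h0.le (d + 1)
    rw [Real.norm_of_nonneg (Real.exp_nonneg _), Real.rpow_neg h0.le,
      ← Nat.cast_add_one, Real.rpow_natCast, ← div_eq_mul_inv, le_div_iff₀ (by positivity)]
    rw [div_le_iff₀ (by positivity)] at h2
    calc _ ≤ Real.exp (-‖z‖) * (Real.exp (1 + ‖z‖) * (d + 1).factorial) := by gcongr
      _ = (Real.exp (-‖z‖) * Real.exp (1 + ‖z‖)) * (d + 1).factorial := by ring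
      _ = _ := by rw [← Real.exp_add]; simp [mul_comm]
  have h2 := h1.comp_smul (inv_ne_zero hρ.ne')
  refine h2.congr (Eventually.of_forall fun z => ?_)
  simp only [norm_smul, norm_inv, Real.norm_of_nonneg hρ.le]
  rw [div_eq_inv_mul]

open FourierTransform in
-- Fourier inversion at the origin: the mass is the symbol at ξ = 0, and (t/8)·(-2)² = t/2.
theorem integral_mixIntegral_gaussMix {t : ℝ} (ht : 0 < t) :
    ∫ z : Sp d, mixIntegral gaussMix t z = Real.exp (-(t / 2)) := by
  have hs := Real.sqrt_pos.2 ht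
  have hM := isMixFamily_gaussMix (d := d)
  have hpi := Real.pi_pos
  -- The dilation by 2π adapts the symbol to the Fourier transform with phase e^{-2πi⟨v, z⟩}; its
  -- Jacobian is the factor (2π)^{-d} in `g`.
  set f : Sp d → ℂ := fun v =>
    cexp (-((√t : ℝ) ^ 2 / 8) * (-2 + ‖(2 * Real.pi) • v‖ ^ 2) ^ 2) with hf
  set g : Sp d → ℂ := fun z => (((2 * Real.pi) ^ d)⁻¹ : ℝ) *
    (((Real.pi / 2 : ℂ) ^ (1 / 2 : ℂ))⁻¹ * ∫ l, gaussMix (√t) z l) with hg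
  have hfc : Continuous f := by fun_prop
  have hfi : Integrable f := by
    have := (integrable_symbol hs (0 : Sp d)).comp_smul (R := 2 * Real.pi) (by positivity)
    simpa [hf] using this
  have hgi : Integrable g := by
    refine Integrable.const_mul (Integrable.const_mul ?_ _) _
    refine ((integrable_exp_neg_norm_div (ρ := 2 * √√t) (by positivity)).const_mul _).mono' ?_
      (Eventually.of_forall fun z => hM.norm_integral_le hs z)
    refine Continuous.aestronglyMeasurable (continuous_iff_continuousAt.2 fun z => ?_)
    have hc : ContinuousAt (fun z : Sp d => (√t, z)) z := by fun_prop
    exact ContinuousAt.comp (f := fun z : Sp d => (√t, z)) (hM.continuousAt_integral hs z) hc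
  have hfg : ∀ z, 𝓕 f z = g (-z) := by
    intro z
    have h1 := Measure.integral_comp_smul_of_nonneg (volume : Measure (Sp d))
      (fun ξ => cexp (-((√t : ℝ) ^ 2 / 8) * (-2 + ‖ξ‖ ^ 2) ^ 2) * cexp (I * inner ℝ (-z) ξ))
      (2 * Real.pi) (hR := by positivity)
    rw [hg]
    simp only
    rw [integral_gaussMix hs, inv_mul_cancel_left₀ pi_div_two_cpow_ne_zero, Real.fourier_eq']
    rw [finrank_euclideanSpace_fin] at h1
    rw [← real_smul, ← h1]
    refine integral_congr_ae (Eventually.of_forall fun v => ?_)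
    simp only [hf, smul_eq_mul]
    rw [mul_comm]
    congr 2
    rw [inner_smul_right, inner_neg_left, real_inner_comm]
    push_cast
    ring
  have hFi : Integrable (𝓕 f) := by
    rw [funext hfg]
    exact hgi.comp_neg
  have h0 := congrFun (hfc.fourierInv_fourier_eq hfi hFi) 0
  rw [Real.fourierInv_eq'] at h0
  simp only [inner_zero_right, ofReal_zero, zero_mul, mul_zero, Complex.exp_zero, one_smul, hfg] at h0
  rw [integral_neg_eq_self g] at h0
  have h1 : ∀ z, mixIntegral gaussMix t z = (g z).re := fun z => by
    rw [hg]
    simp only [re_ofReal_mul, mixIntegral]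
  simp_rw [h1]
  have h2 : ∫ z, (g z).re = (∫ z, g z).re := integral_re hgi
  rw [h2, h0, hf]
  simp only [smul_zero, norm_zero]
  rw [← ofReal_pow, Real.sq_sqrt ht.le]
  have : (-(t / 8 : ℂ) * (-2 + ((0 : ℝ) : ℂ) ^ 2) ^ 2) = ((-(t / 2) : ℝ) : ℂ) := by
    push_cast
    ring
  rw [this, ← ofReal_exp, ofReal_re]

end KernelBounds

end

/-! ### Operator bounds and norm continuity in time for parabolic kernels. -/

noncomputable section

namespace IsParabolicKernel

open Filter Topology
open scoped ENNReal

variable {d : ℕ} {k : ℝ → Sp d → ℝ} {β : ℝ}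

theorem continuousAt (h : IsParabolicKernel k β) {t : ℝ} (ht : 0 < t) (z : Sp d) :
    ContinuousAt (Function.uncurry k) (t, z) :=
  h.continuousOn.continuousAt ((isOpen_Ioi.prod isOpen_univ).mem_nhds ⟨ht, mem_univ _⟩)

theorem continuous (h : IsParabolicKernel k β) {t : ℝ} (ht : 0 < t) : Continuous (k t) := by
  refine continuous_iff_continuousAt.2 fun z => ?_
  have hc : ContinuousAt (fun z : Sp d => (t, z)) z := by fun_prop
  exact ContinuousAt.comp (f := fun z : Sp d => (t, z)) (h.continuousAt ht z) hc

/-- A single integrable majorant in y for all nearby times and base points, the input to each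
dominated convergence at positive time. -/
theorem eventually_le (h : IsParabolicKernel k β) {t₀ : ℝ} (ht₀ : 0 < t₀) (x₀ : Sp d) :
    ∃ c a : ℝ, 0 ≤ c ∧ 0 < a ∧ ∀ᶠ p : ℝ × Sp d in 𝓝 (t₀, x₀), ∀ y,
      |k p.1 (p.2 - y)| ≤ c * Real.exp (-(‖x₀ - y‖ / a)) := by
  obtain ⟨C, hC, hb⟩ := h.bound
  -- The scale at time t₀ + 1 dominates all scales at nearby times; `exp (1 / a)` below pays for
  -- moving the base point by at most 1, and the `+ 1` in `c` leaves room for the prefactor to vary.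
  set a := 2 * √√(t₀ + 1) with ha
  have ha0 : 0 < a := by positivity
  set c := C * Real.exp (2 * √t₀) * t₀ ^ (-(β + d / 4)) + 1 with hc
  have hc0 : 0 ≤ c := by positivity
  refine ⟨c * Real.exp (1 / a), a, by positivity, ha0, ?_⟩
  have hcont : ContinuousAt (fun p : ℝ × Sp d => C * Real.exp (2 * √p.1) * p.1 ^ (-(β + d / 4)))
      (t₀, x₀) :=
    ContinuousAt.mul (by fun_prop) (ContinuousAt.rpow_const (by fun_prop) (Or.inl ht₀.ne'))
  have h1 : ∀ᶠ p : ℝ × Sp d in 𝓝 (t₀, x₀), 0 < p.1 :=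
    continuous_fst.continuousAt.eventually (lt_mem_nhds ht₀)
  have h2 : ∀ᶠ p : ℝ × Sp d in 𝓝 (t₀, x₀), p.1 < t₀ + 1 :=
    continuous_fst.continuousAt.eventually (gt_mem_nhds (by simp))
  have h3 : ∀ᶠ p : ℝ × Sp d in 𝓝 (t₀, x₀), dist p.2 x₀ < 1 :=
    (isOpen_lt (by fun_prop) continuous_const).mem_nhds (by simp)
  filter_upwards [h1, h2, h3, hcont.eventually (gt_mem_nhds (lt_add_one _))] with p hp1 hp2 hp3 hp4 y
  have h5 : ‖x₀ - y‖ ≤ 1 + ‖p.2 - y‖ := by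
    have := norm_add_le (x₀ - p.2) (p.2 - y)
    rw [sub_add_sub_cancel] at this
    rw [dist_comm, dist_eq_norm] at hp3
    linarith
  have h6 : Real.exp (-(‖p.2 - y‖ / (2 * √√p.1))) ≤ Real.exp (1 / a) * Real.exp (-(‖x₀ - y‖ / a)) := by
    rw [← Real.exp_add]
    refine Real.exp_le_exp.2 ?_
    have h7 : ‖p.2 - y‖ / a ≤ ‖p.2 - y‖ / (2 * √√p.1) := by
      rw [ha]
      gcongr
    have h8 : ‖x₀ - y‖ / a ≤ (1 + ‖p.2 - y‖) / a := by gcongr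
    rw [add_div] at h8
    linarith
  refine (hb p.1 hp1 _).trans ?_
  rw [mul_assoc c]
  exact mul_le_mul hp4.le h6 (Real.exp_nonneg _) hc0

theorem eventually_le' (h : IsParabolicKernel k β) {t₀ : ℝ} (ht₀ : 0 < t₀) :
    ∃ c a : ℝ, 0 ≤ c ∧ 0 < a ∧ ∀ᶠ t in 𝓝 t₀, ∀ z, |k t z| ≤ c * Real.exp (-(‖z‖ / a)) := by
  obtain ⟨c, a, hc, ha, hev⟩ := h.eventually_le ht₀ 0
  refine ⟨c, a, hc, ha, ?_⟩
  have hcont : ContinuousAt (fun t : ℝ => (t, (0 : Sp d))) t₀ := by fun_prop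
  filter_upwards [hcont.eventually hev] with t ht z
  simpa using ht (-z)

theorem isBddKernel_exp {c a : ℝ} (hc : 0 ≤ c) (ha : 0 < a) :
    IsBddKernel fun z : Sp d => c * Real.exp (-(‖z‖ / a)) where
  measurable := by fun_prop
  integrable := (integrable_exp_neg_norm_div ha).const_mul c
  bdd := ⟨c, fun z => by
    rw [abs_of_nonneg (by positivity)]
    refine mul_le_of_le_one_right hc (Real.exp_le_one_iff.2 ?_)
    rw [neg_nonpos]
    positivity⟩

theorem isBddKernel (h : IsParabolicKernel k β) {t : ℝ} (ht : 0 < t) : IsBddKernel (k t) := by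
  obtain ⟨c, a, hc, ha, hev⟩ := h.eventually_le' ht
  have hb := isBddKernel_exp (d := d) hc ha
  obtain ⟨B, hB⟩ := hb.bdd
  have hle := hev.self_of_nhds
  exact ⟨(h.continuous ht).measurable, hb.integrable.mono' (h.continuous ht).aestronglyMeasurable
    (Eventually.of_forall hle), B, fun z => (hle z).trans ((le_abs_self _).trans (hB z))⟩

/-- Parabolic rescaling with a test function: f = 1 gives the L¹ norm, and a modulus of translation
continuity gives the approximate identity. -/
theorem integral_exp_neg_norm_div (ρ : ℝ) (hρ : 0 < ρ) (f : Sp d → ℝ) :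
    ∫ z : Sp d, Real.exp (-(‖z‖ / (2 * ρ))) * f z =
      ρ ^ d * ∫ z : Sp d, Real.exp (-(‖z‖ / 2)) * f (ρ • z) := by
  have h := Measure.integral_comp_smul_of_nonneg (volume : Measure (Sp d))
    (fun z => Real.exp (-(‖z‖ / (2 * ρ))) * f z) ρ (hR := hρ.le)
  rw [finrank_euclideanSpace_fin, smul_eq_mul] at h
  have e : ∀ z : Sp d, Real.exp (-(‖z‖ / 2)) * f (ρ • z) =
      Real.exp (-(‖ρ • z‖ / (2 * ρ))) * f (ρ • z) := by
    intro z
    rw [norm_smul, Real.norm_of_nonneg hρ.le]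
    congr 3
    field_simp
  simp_rw [e]
  rw [h, mul_inv_cancel_left₀ (by positivity)]

theorem sqrt_sqrt_pow {t : ℝ} (ht : 0 < t) (d : ℕ) : (√√t) ^ d = t ^ (d / 4 : ℝ) := by
  rw [Real.sqrt_eq_rpow, Real.sqrt_eq_rpow, ← Real.rpow_mul ht.le, ← Real.rpow_natCast,
    ← Real.rpow_mul ht.le]
  congr 1
  ring

/-- On bounded time intervals a parabolic kernel is dominated by a rescaled exponential. -/
theorem exists_bound_exp (h : IsParabolicKernel k β) (T : ℝ) :
    ∃ C, 0 ≤ C ∧ ∀ t ∈ Ioc 0 T, ∀ z, |k t z| ≤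
      C * t ^ (-(β + d / 4)) * Real.exp (-(‖z‖ / (2 * √√t))) := by
  obtain ⟨C, hC, hb⟩ := h.bound
  refine ⟨C * Real.exp (2 * √T), by positivity, fun t ht z => (hb t ht.1 z).trans ?_⟩
  have ht0 := ht.1
  have := ht.2
  gcongr

theorem exists_bound (h : IsParabolicKernel k β) (T : ℝ) :
    ∃ C, 0 ≤ C ∧ ∀ t ∈ Ioc 0 T, ∫ z, |k t z| ≤ C * t ^ (-β) ∧
      ∀ z, |k t z| ≤ C * t ^ (-(β + d / 4)) := by
  obtain ⟨C, hC, hb⟩ := h.exists_bound_exp T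
  set J := ∫ z : Sp d, Real.exp (-(‖z‖ / 2)) * (1 : ℝ)
  have hJ : 0 ≤ J := integral_nonneg fun z => by positivity
  -- One constant serves both estimates: C J is needed for the integral and C for the supremum.
  refine ⟨C * (J + 1), by positivity, fun t ht => ⟨?_, fun z => ?_⟩⟩
  · have ht0 := ht.1
    have hρ : 0 < √√t := by positivity
    have h1 := integral_exp_neg_norm_div (d := d) (√√t) hρ (fun _ => 1)
    rw [sqrt_sqrt_pow ht0] at h1
    simp only [mul_one] at h1
    have hi := (integrable_exp_neg_norm_div (d := d) (ρ := 2 * √√t) (by positivity)).const_mul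
      (C * t ^ (-(β + d / 4)))
    calc _ ≤ ∫ z : Sp d, C * t ^ (-(β + d / 4)) * Real.exp (-(‖z‖ / (2 * √√t))) :=
          integral_mono_of_nonneg (Eventually.of_forall fun z => abs_nonneg _) hi
            (Eventually.of_forall fun z => hb t ht z)
      _ = C * (t ^ (-(β + d / 4)) * t ^ (d / 4 : ℝ)) * J := by
          rw [integral_const_mul, h1]
          simp only [J, mul_one]
          ring
      _ = C * t ^ (-β) * J := by
          rw [← Real.rpow_add ht0]
          congr 3
          ring
      _ ≤ _ := by
          have : 0 ≤ C * t ^ (-β) := by positivity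
          nlinarith
  · have ht0 := ht.1
    have h0 : 0 ≤ C * t ^ (-(β + d / 4)) := by positivity
    refine (hb t ht z).trans ((mul_le_of_le_one_right h0 (Real.exp_le_one_iff.2 ?_)).trans ?_)
    · rw [neg_nonpos]
      positivity
    · nlinarith

section Operators

variable {q r : ℝ} [hq : Fact (1 ≤ ENNReal.ofReal q)] [hr : Fact (1 ≤ ENNReal.ofReal r)]

theorem exists_norm_convLp_le (h : IsParabolicKernel k β) (hqr : q ≤ r) (T : ℝ) :
    ∃ C, 0 ≤ C ∧ ∀ t ∈ Ioc 0 T,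
      ‖convLp q r (k t)‖ ≤ C * t ^ (-(β + d / 4 * (1 / q - 1 / r))) := by
  have hq1 := ENNReal.one_le_ofReal.1 hq.out
  obtain ⟨C, hC, hb⟩ := h.exists_bound T
  refine ⟨C, hC, fun t ht => ?_⟩
  have ht0 := ht.1
  have h1 := norm_convLp_le (q := q) (r := r) (h.isBddKernel ht.1) hqr (hb t ht).2
  have ha := (one_sub_one_div_sub_pos hq1 hqr).le
  have hb0 := one_div_sub_nonneg hq1 hqr
  set b := 1 / q - 1 / r
  calc _ ≤ _ := h1
    _ ≤ (C * t ^ (-β)) ^ (1 - b) * (C * t ^ (-(β + d / 4))) ^ b := by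
        gcongr
        exact (hb t ht).1
    _ = (C ^ (1 - b) * C ^ b) * (t ^ (-β * (1 - b)) * t ^ (-(β + d / 4) * b)) := by
        rw [Real.mul_rpow hC (by positivity), Real.mul_rpow hC (by positivity),
          ← Real.rpow_mul ht0.le, ← Real.rpow_mul ht0.le]
        ring
    _ = _ := by
        rw [← Real.rpow_add_of_nonneg hC ha hb0, ← Real.rpow_add ht0]
        simp only [sub_add_cancel, Real.rpow_one]
        congr 2
        ring

theorem continuousOn_convLp (h : IsParabolicKernel k β) (hqr : q ≤ r) :
    ContinuousOn (fun t => convLp q r (k t)) (Ioi 0) := by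
  intro t₀ ht₀
  have ht₀' : 0 < t₀ := ht₀
  refine ContinuousAt.continuousWithinAt ?_
  have hq1 := ENNReal.one_le_ofReal.1 hq.out
  have ha := one_sub_one_div_sub_pos hq1 hqr
  obtain ⟨c, a, hc, ha0, hev⟩ := h.eventually_le' ht₀
  have hexp : ∀ z : Sp d, c * Real.exp (-(‖z‖ / a)) ≤ c := fun z => by
    refine mul_le_of_le_one_right hc (Real.exp_le_one_iff.2 ?_)
    rw [neg_nonpos]
    positivity
  have hlim : Tendsto (fun t => ∫ z, |(k t - k t₀) z|) (𝓝 t₀) (𝓝 0) := by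
    have : Tendsto (fun t => ∫ z, |(k t - k t₀) z|) (𝓝 t₀) (𝓝 (∫ z : Sp d, (0 : ℝ))) := by
      refine tendsto_integral_filter_of_dominated_convergence
        (fun z => c * Real.exp (-(‖z‖ / a)) + c * Real.exp (-(‖z‖ / a))) ?_ ?_ ?_ ?_
      · filter_upwards [lt_mem_nhds ht₀'] with t ht
        exact ((h.continuous ht).sub (h.continuous ht₀)).abs.aestronglyMeasurable
      · filter_upwards [hev] with t ht
        refine Eventually.of_forall fun z => ?_
        rw [Real.norm_eq_abs, abs_abs]
        exact (abs_sub _ _).trans (add_le_add (ht z) (hev.self_of_nhds z))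
      · exact ((integrable_exp_neg_norm_div ha0).const_mul c).add
          ((integrable_exp_neg_norm_div ha0).const_mul c)
      · refine Eventually.of_forall fun z => ?_
        have hc : ContinuousAt (fun t : ℝ => (t, z)) t₀ := by fun_prop
        have h1 : ContinuousAt (fun t => k t z) t₀ :=
          ContinuousAt.comp (f := fun t : ℝ => (t, z)) (h.continuousAt ht₀ z) hc
        have h2 := (h1.sub (continuousAt_const (y := k t₀ z))).abs.tendsto
        simpa using h2
    simpa using this
  rw [ContinuousAt, tendsto_iff_norm_sub_tendsto_zero]
  -- Only the L¹ norm of the difference has to vanish: its exponent is strictly positive, and a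
  -- bound on the supremum suffices.
  have hlim2 : Tendsto (fun t => (∫ z, |(k t - k t₀) z|) ^ (1 - (1 / q - 1 / r)) *
      (c + c) ^ (1 / q - 1 / r)) (𝓝 t₀) (𝓝 0) := by
    have := (hlim.rpow_const (Or.inr ha.le)).mul_const ((c + c) ^ (1 / q - 1 / r))
    rwa [Real.zero_rpow ha.ne', zero_mul] at this
  refine squeeze_zero' (Eventually.of_forall fun t => norm_nonneg _) ?_ hlim2
  filter_upwards [hev, lt_mem_nhds ht₀'] with t ht ht0
  rw [← convLp_sub (h.isBddKernel ht0) (h.isBddKernel ht₀) hqr]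
  refine norm_convLp_le ((h.isBddKernel ht0).sub (h.isBddKernel ht₀)) hqr fun z => ?_
  exact (abs_sub _ _).trans (add_le_add ((ht z).trans (hexp z))
    ((hev.self_of_nhds z).trans (hexp z)))

end Operators

end IsParabolicKernel

end

/-! ### The approximate identity, and pointwise values of Duhamel integrals. -/

noncomputable section

open Filter Topology
open scoped ENNReal

section Translation

variable {d : ℕ} {q r : ℝ}

theorem convFun_sub {k v w : Sp d → ℝ} (hk : IsBddKernel k) (hq1 : 1 ≤ q)
    (hv : MemLp v (ENNReal.ofReal q)) (hw : MemLp w (ENNReal.ofReal q)) (x : Sp d) :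
    convFun k (v - w) x = convFun k v x - convFun k w x := by
  rw [convFun, convFun, convFun, ← integral_sub (integrable_convFun hk hq1 hv x)
    (integrable_convFun hk hq1 hw x)]
  simp [mul_sub]

/-- The translate `x ↦ v (x - z)` of an `L^r` function. -/
def translateLp (z : Sp d) (v : Lp ℝ (ENNReal.ofReal r) (volume : Measure (Sp d))) :
    Lp ℝ (ENNReal.ofReal r) (volume : Measure (Sp d)) :=
  DomAddAct.mk (-z) +ᵥ v

theorem translateLp_zero (v : Lp ℝ (ENNReal.ofReal r) (volume : Measure (Sp d))) :
    translateLp 0 v = v := by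
  rw [translateLp, neg_zero]
  exact zero_vadd _ v

theorem norm_translateLp (z : Sp d) (v : Lp ℝ (ENNReal.ofReal r) (volume : Measure (Sp d))) :
    ‖translateLp z v‖ = ‖v‖ :=
  DomAddAct.norm_vadd_Lp _ _

variable [hq : Fact (1 ≤ ENNReal.ofReal q)] [hr : Fact (1 ≤ ENNReal.ofReal r)]

/-- Pointwise bound for the convolution with a kernel dominated by a fixed one. -/
theorem exists_abs_convFun_le {D : Sp d → ℝ} (hD : IsBddKernel D) :
    ∃ C : ℝ, 0 ≤ C ∧ ∀ k : Sp d → ℝ, (∀ z, |k z| ≤ D z) →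
      ∀ (v : Lp ℝ (ENNReal.ofReal q) (volume : Measure (Sp d))) (x : Sp d),
        |convFun k v x| ≤ C * ‖v‖ := by
  have hq1 := ENNReal.one_le_ofReal.1 hq.out
  have hq0 : 0 < q := by linarith
  obtain ⟨B, hB, hDB⟩ := hD.exists_enorm_le
  set K := ((∫⁻ z, ‖D z‖ₑ) ^ (q - 1) * B) ^ (1 / q) with hK
  have hKt : K ≠ ∞ := ENNReal.rpow_ne_top_of_nonneg (by positivity) (ENNReal.mul_ne_top
    (ENNReal.rpow_ne_top_of_nonneg (by linarith) hD.integrable.2.ne) hB)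
  refine ⟨K.toReal, ENNReal.toReal_nonneg, fun k hk v x => ?_⟩
  have h1 : ‖convFun k v x‖ₑ ≤ K * ‖v‖ₑ := by
    calc _ ≤ absConv k v x := enorm_convFun_le x
      _ ≤ absConv D v x := by
        refine lintegral_mono fun y => ?_
        gcongr
        rw [Real.enorm_eq_ofReal_abs, Real.enorm_eq_ofReal_abs]
        exact ENNReal.ofReal_le_ofReal ((hk _).trans (le_abs_self _))
      _ ≤ ((∫⁻ z, ‖D z‖ₑ) ^ (q - 1) * (B * ∫⁻ y, ‖v y‖ₑ ^ q)) ^ (1 / q) := by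
        rw [one_div, ENNReal.le_rpow_inv_iff hq0]
        exact absConv_rpow_le_sup hD.measurable (Lp.aestronglyMeasurable v).aemeasurable hq1 hDB x
      _ = _ := by
        rw [← mul_assoc, ENNReal.mul_rpow_of_nonneg _ _ (by positivity), Lp.enorm_def,
          eLpNorm_eq_lintegral_rpow_enorm_toReal (by simpa using hq0) ENNReal.ofReal_ne_top,
          ENNReal.toReal_ofReal hq0.le]
  rw [← Real.norm_eq_abs, ← toReal_enorm, ← toReal_enorm v, ← ENNReal.toReal_mul]
  exact ENNReal.toReal_mono (ENNReal.mul_ne_top hKt enorm_ne_top) h1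

instance fact_ofReal_ne_top (r : ℝ) : Fact (ENNReal.ofReal r ≠ ∞) := ⟨ENNReal.ofReal_ne_top⟩

theorem continuous_translateLp (v : Lp ℝ (ENNReal.ofReal r) (volume : Measure (Sp d))) :
    Continuous fun z : Sp d => translateLp z v := by
  have h : Continuous fun z : Sp d => DomAddAct.mk (-z) :=
    DomAddAct.continuous_mk.comp continuous_neg
  exact h.vadd continuous_const

theorem lintegral_translateLp_sub (z : Sp d)
    (v : Lp ℝ (ENNReal.ofReal r) (volume : Measure (Sp d))) :
    ∫⁻ x, ‖v (x - z) - v x‖ₑ ^ r = ‖translateLp z v - v‖ₑ ^ r := by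
  have hr1 := ENNReal.one_le_ofReal.1 hr.out
  have hr0 : 0 < r := by linarith
  rw [Lp.enorm_def, eLpNorm_eq_lintegral_rpow_enorm_toReal (by simpa using hr0)
    ENNReal.ofReal_ne_top, ENNReal.toReal_ofReal hr0.le, ← ENNReal.rpow_mul,
    one_div_mul_cancel hr0.ne', ENNReal.rpow_one]
  refine lintegral_congr_ae ?_
  filter_upwards [Lp.coeFn_sub (translateLp z v) v, DomAddAct.vadd_Lp_ae_eq (DomAddAct.mk (-z)) v]
    with x h1 h2
  rw [h1, Pi.sub_apply, translateLp, h2]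
  simp [sub_eq_neg_add]

/-- Subtracting (∫ k) v(x) instead of v(x) avoids normalizing the mass, and weighting by |k| covers
kernels of either sign. -/
theorem enorm_convFun_sub_rpow_le {k : Sp d → ℝ} (hk : IsBddKernel k)
    (v : Lp ℝ (ENNReal.ofReal r) (volume : Measure (Sp d))) (x : Sp d) :
    ‖convFun k v x - (∫ z, k z) * v x‖ₑ ^ r ≤
      (∫⁻ z, ‖k z‖ₑ) ^ (r - 1) * ∫⁻ z, ‖k z‖ₑ * ‖v (x - z) - v x‖ₑ ^ r := by
  have hr1 := ENNReal.one_le_ofReal.1 hr.out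
  have hvm : Measurable v := (Lp.stronglyMeasurable v).measurable
  have h1 : convFun k v x = ∫ z, k z * v (x - z) := by
    rw [← integral_sub_left_eq_self (fun z => k z * v (x - z)) volume x]
    simp [convFun]
  have hi : Integrable fun z => k z * v (x - z) := by
    have := (integrable_convFun hk hr1 (Lp.memLp v) x).comp_sub_left x
    simpa using this
  have h2 : convFun k v x - (∫ z, k z) * v x = ∫ z, k z * (v (x - z) - v x) := by
    rw [h1, ← integral_mul_const, ← integral_sub hi (hk.integrable.mul_const _)]
    simp [mul_sub]
  rw [h2]
  have h3 : ‖∫ z, k z * (v (x - z) - v x)‖ₑ ≤ ∫⁻ z, ‖k z‖ₑ * ‖v (x - z) - v x‖ₑ := by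
    refine (enorm_integral_le_lintegral_enorm _).trans (le_of_eq ?_)
    simp only [enorm_mul]
  have hkm := hk.measurable
  exact (ENNReal.rpow_le_rpow h3 (by linarith)).trans
    (ENNReal.lintegral_mul_rpow_le (by fun_prop) (by fun_prop) hr1)

theorem norm_convLp_sub_rpow_le {k : Sp d → ℝ} (hk : IsBddKernel k)
    (v : Lp ℝ (ENNReal.ofReal r) (volume : Measure (Sp d))) :
    ‖convLp r r k v - (∫ z, k z) • v‖ ^ r ≤
      (∫ z, |k z|) ^ (r - 1) * ∫ z, |k z| * ‖translateLp z v - v‖ ^ r := by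
  have hr1 := ENNReal.one_le_ofReal.1 hr.out
  have hr0 : 0 < r := by linarith
  have hvm : Measurable v := (Lp.stronglyMeasurable v).measurable
  have hkm := hk.measurable
  have hφ : Continuous fun z : Sp d => ‖translateLp z v - v‖ ^ r :=
    ((continuous_translateLp v).sub continuous_const).norm.rpow_const fun _ => Or.inr hr0.le
  have hi : Integrable fun z => |k z| * ‖translateLp z v - v‖ ^ r := by
    refine (hk.integrable.abs.mul_const ((2 * ‖v‖) ^ r)).mono'
      (hkm.abs.aestronglyMeasurable.mul hφ.aestronglyMeasurable) (Eventually.of_forall fun z => ?_)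
    rw [Real.norm_of_nonneg (by positivity)]
    gcongr
    refine (norm_sub_le _ _).trans ?_
    rw [norm_translateLp]
    linarith
  have h1 : ‖convLp r r k v - (∫ z, k z) • v‖ₑ ^ r ≤
      (∫⁻ z, ‖k z‖ₑ) ^ (r - 1) * ∫⁻ z, ‖k z‖ₑ * ‖translateLp z v - v‖ₑ ^ r := by
    rw [Lp.enorm_def, eLpNorm_eq_lintegral_rpow_enorm_toReal (by simpa using hr0)
      ENNReal.ofReal_ne_top, ENNReal.toReal_ofReal hr0.le, ← ENNReal.rpow_mul,
      one_div_mul_cancel hr0.ne', ENNReal.rpow_one]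
    calc _ = ∫⁻ x, ‖convFun k v x - (∫ z, k z) * v x‖ₑ ^ r := by
          refine lintegral_congr_ae ?_
          filter_upwards [Lp.coeFn_sub (convLp r r k v) ((∫ z, k z) • v),
            Lp.coeFn_smul (∫ z, k z) v, coeFn_convLp hk le_rfl v] with x e1 e2 e3
          rw [e1, Pi.sub_apply, e2, e3]
          rfl
      _ ≤ ∫⁻ x, (∫⁻ z, ‖k z‖ₑ) ^ (r - 1) * ∫⁻ z, ‖k z‖ₑ * ‖v (x - z) - v x‖ₑ ^ r :=
          lintegral_mono fun x => enorm_convFun_sub_rpow_le hk v x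
      _ = (∫⁻ z, ‖k z‖ₑ) ^ (r - 1) * ∫⁻ x, ∫⁻ z, ‖k z‖ₑ * ‖v (x - z) - v x‖ₑ ^ r :=
          lintegral_const_mul _ (Measurable.lintegral_prod_right' (f := fun p : Sp d × Sp d =>
            ‖k p.2‖ₑ * ‖v (p.1 - p.2) - v p.1‖ₑ ^ r) (by fun_prop))
      _ = _ := by
          rw [lintegral_lintegral_swap (Measurable.aemeasurable (by fun_prop))]
          congr 1
          refine lintegral_congr fun z => ?_
          rw [lintegral_const_mul _ (by fun_prop), lintegral_translateLp_sub]
  have e1 : ∫ z, |k z| = (∫⁻ z, ‖k z‖ₑ).toReal := by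
    rw [← integral_norm_eq_lintegral_enorm hk.integrable.1]; rfl
  have e2 : ∫⁻ z, ‖k z‖ₑ * ‖translateLp z v - v‖ₑ ^ r =
      ENNReal.ofReal (∫ z, |k z| * ‖translateLp z v - v‖ ^ r) := by
    rw [ofReal_integral_eq_lintegral_ofReal hi (Eventually.of_forall fun z => by positivity)]
    refine lintegral_congr fun z => ?_
    rw [ENNReal.ofReal_mul (abs_nonneg _), ← Real.enorm_eq_ofReal_abs,
      ← ENNReal.ofReal_rpow_of_nonneg (norm_nonneg _) hr0.le, ofReal_norm]
  rw [e2] at h1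
  have h2 := ENNReal.toReal_mono (ENNReal.mul_ne_top (ENNReal.rpow_ne_top_of_nonneg (by linarith)
    hk.integrable.2.ne) ENNReal.ofReal_ne_top) h1
  rwa [ENNReal.toReal_mul, ← ENNReal.toReal_rpow, ← ENNReal.toReal_rpow, toReal_enorm,
    ENNReal.toReal_ofReal (integral_nonneg fun z => by positivity), ← e1] at h2

end Translation

namespace IsParabolicKernel

variable {d : ℕ} {k : ℝ → Sp d → ℝ} {β : ℝ} {q r : ℝ} [hq : Fact (1 ≤ ENNReal.ofReal q)]
  [hr : Fact (1 ≤ ENNReal.ofReal r)]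

/-- A parabolic kernel whose mass tends to `1` is an approximate identity in `L^r`. -/
theorem tendsto_convLp_zero (h : IsParabolicKernel k 0)
    (hmass : Tendsto (fun t => ∫ z, k t z) (𝓝[>] 0) (𝓝 1))
    (v : Lp ℝ (ENNReal.ofReal r) (volume : Measure (Sp d))) :
    Tendsto (fun t => convLp r r (k t) v) (𝓝[>] 0) (𝓝 v) := by
  have hr1 := ENNReal.one_le_ofReal.1 hr.out
  have hr0 : 0 < r := by linarith
  obtain ⟨C, hC, hb⟩ := h.exists_bound 1
  obtain ⟨C', hC', hb'⟩ := h.exists_bound_exp 1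
  set φ : Sp d → ℝ := fun z => ‖translateLp z v - v‖ ^ r with hφ
  have hφc : Continuous φ :=
    ((continuous_translateLp v).sub continuous_const).norm.rpow_const fun _ => Or.inr hr0.le
  have hφ0 : φ 0 = 0 := by simp [hφ, translateLp_zero, Real.zero_rpow hr0.ne']
  have hφn : ∀ z, 0 ≤ φ z := fun z => by positivity
  have hφb : ∀ z, φ z ≤ (2 * ‖v‖) ^ r := fun z => by
    simp only [hφ]
    gcongr
    refine (norm_sub_le _ _).trans ?_
    rw [norm_translateLp]
    linarith
  have hρ : Tendsto (fun t : ℝ => √√t) (𝓝[>] 0) (𝓝 0) := by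
    have : ContinuousAt (fun t : ℝ => √√t) 0 := by fun_prop
    simpa using this.tendsto.mono_left nhdsWithin_le_nhds
  have hlim : Tendsto (fun t : ℝ => ∫ z : Sp d, Real.exp (-(‖z‖ / 2)) * φ (√√t • z)) (𝓝[>] 0)
      (𝓝 0) := by
    have : Tendsto (fun t : ℝ => ∫ z : Sp d, Real.exp (-(‖z‖ / 2)) * φ (√√t • z)) (𝓝[>] 0)
        (𝓝 (∫ z : Sp d, (0 : ℝ))) := by
      refine tendsto_integral_filter_of_dominated_convergence
        (fun z => Real.exp (-(‖z‖ / 2)) * (2 * ‖v‖) ^ r) ?_ ?_ ?_ ?_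
      · exact Eventually.of_forall fun t => Continuous.aestronglyMeasurable (by fun_prop)
      · refine Eventually.of_forall fun t => Eventually.of_forall fun z => ?_
        rw [Real.norm_of_nonneg (mul_nonneg (Real.exp_nonneg _) (hφn _))]
        exact mul_le_mul_of_nonneg_left (hφb _) (Real.exp_nonneg _)
      · exact (integrable_exp_neg_norm_div two_pos).mul_const _
      · refine Eventually.of_forall fun z => ?_
        have h1 : Tendsto (fun t : ℝ => φ (√√t • z)) (𝓝[>] 0) (𝓝 (φ ((0 : ℝ) • z))) :=
          (hφc.tendsto _).comp (hρ.smul_const z)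
        have h2 := h1.const_mul (Real.exp (-(‖z‖ / 2)))
        simpa [hφ0] using h2
    simpa using this
  have hmain : Tendsto (fun t => ‖convLp r r (k t) v - (∫ z, k t z) • v‖ ^ r) (𝓝[>] 0) (𝓝 0) := by
    have hlim2 := (hlim.const_mul C').const_mul (C ^ (r - 1))
    rw [mul_zero, mul_zero] at hlim2
    refine squeeze_zero' (Eventually.of_forall fun t => by positivity) ?_ hlim2
    filter_upwards [Ioc_mem_nhdsGT one_pos] with t ht
    have ht0 := ht.1
    refine (norm_convLp_sub_rpow_le (h.isBddKernel ht.1) v).trans ?_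
    have h1 : ∫ z, |k t z| ≤ C := by simpa using (hb t ht).1
    -- Rescaling by t^{1/4} cancels the prefactor t^{-d/4}. What remains tends to 0 because
    -- translations are continuous in L^r.
    have h2 : ∫ z, |k t z| * φ z ≤ C' * ∫ z : Sp d, Real.exp (-(‖z‖ / 2)) * φ (√√t • z) := by
      have hi : Integrable fun z : Sp d =>
          C' * t ^ (-(0 + d / 4) : ℝ) * (Real.exp (-(‖z‖ / (2 * √√t))) * φ z) := by
        refine Integrable.const_mul ?_ _
        refine ((integrable_exp_neg_norm_div (ρ := 2 * √√t) (by positivity)).mul_const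
          ((2 * ‖v‖) ^ r)).mono' (Continuous.aestronglyMeasurable (by fun_prop))
          (Eventually.of_forall fun z => ?_)
        rw [Real.norm_of_nonneg (mul_nonneg (Real.exp_nonneg _) (hφn _))]
        exact mul_le_mul_of_nonneg_left (hφb _) (Real.exp_nonneg _)
      calc _ ≤ ∫ z : Sp d, C' * t ^ (-(0 + d / 4) : ℝ) * (Real.exp (-(‖z‖ / (2 * √√t))) * φ z) := by
            refine integral_mono_of_nonneg (Eventually.of_forall fun z =>
              mul_nonneg (abs_nonneg _) (hφn z)) hi (Eventually.of_forall fun z => ?_)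
            simp only
            rw [← mul_assoc]
            exact mul_le_mul_of_nonneg_right (hb' t ht z) (hφn z)
        _ = C' * (t ^ (-(0 + d / 4) : ℝ) * t ^ (d / 4 : ℝ)) *
            ∫ z : Sp d, Real.exp (-(‖z‖ / 2)) * φ (√√t • z) := by
            rw [integral_const_mul, integral_exp_neg_norm_div _ (by positivity),
              sqrt_sqrt_pow ht0]
            ring
        _ = _ := by
            rw [← Real.rpow_add ht0]
            simp
    have h3 : 0 ≤ ∫ z, |k t z| * φ z := integral_nonneg fun z => mul_nonneg (abs_nonneg _) (hφn z)
    have h4 : 0 ≤ ∫ z, |k t z| := integral_nonneg fun z => abs_nonneg _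
    exact mul_le_mul (Real.rpow_le_rpow h4 h1 (by linarith)) h2 h3 (by positivity)
  have h1 : Tendsto (fun t => convLp r r (k t) v - (∫ z, k t z) • v) (𝓝[>] 0) (𝓝 0) := by
    rw [tendsto_zero_iff_norm_tendsto_zero]
    have := hmain.rpow_const (p := 1 / r) (Or.inr (by positivity))
    rw [Real.zero_rpow (by positivity)] at this
    refine this.congr fun t => ?_
    rw [← Real.rpow_mul (norm_nonneg _), mul_one_div_cancel hr0.ne', Real.rpow_one]
  have h2 := h1.add (hmass.smul_const v)
  simpa using h2

/-- Split v = v₀ + (v - v₀): the fixed part is handled by dominated convergence, the rest by a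
pointwise bound uniform over nearby times and all points. Joint continuity is what makes the Duhamel
integrand measurable in (s, x). -/
theorem continuousAt_convFun (h : IsParabolicKernel k β) {t₀ : ℝ} (ht₀ : 0 < t₀)
    (v₀ : Lp ℝ (ENNReal.ofReal q) (volume : Measure (Sp d))) (x₀ : Sp d) :
    ContinuousAt (fun p : ℝ × Lp ℝ (ENNReal.ofReal q) (volume : Measure (Sp d)) × Sp d =>
      convFun (k p.1) p.2.1 p.2.2) (t₀, v₀, x₀) := by
  have hq1 := ENNReal.one_le_ofReal.1 hq.out
  have hpos : ∀ᶠ p : ℝ × Lp ℝ (ENNReal.ofReal q) (volume : Measure (Sp d)) × Sp d in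
      𝓝 (t₀, v₀, x₀), 0 < p.1 :=
    continuous_fst.continuousAt.eventually (lt_mem_nhds ht₀)
  have hfix : ContinuousAt (fun p : ℝ × Sp d => convFun (k p.1) v₀ p.2) (t₀, x₀) := by
    obtain ⟨c, a, hc, ha, hev⟩ := h.eventually_le ht₀ x₀
    have hpos' : ∀ᶠ p : ℝ × Sp d in 𝓝 (t₀, x₀), 0 < p.1 :=
      continuous_fst.continuousAt.eventually (lt_mem_nhds ht₀)
    refine continuousAt_of_dominated
      (bound := fun y => ‖c * Real.exp (-(‖x₀ - y‖ / a)) * v₀ y‖) ?_ ?_ ?_ ?_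
    · filter_upwards [hpos'] with p hp
      exact (integrable_convFun (h.isBddKernel hp) hq1 (Lp.memLp v₀) p.2).1
    · filter_upwards [hev] with p hp
      refine Eventually.of_forall fun y => ?_
      rw [norm_mul, norm_mul]
      refine mul_le_mul_of_nonneg_right ?_ (norm_nonneg _)
      exact (hp y).trans (le_abs_self _)
    · exact (integrable_convFun (isBddKernel_exp hc ha) hq1 (Lp.memLp v₀) x₀).norm
    · refine Eventually.of_forall fun y => ContinuousAt.mul ?_ continuousAt_const
      have hcc : ContinuousAt (fun p : ℝ × Sp d => (p.1, p.2 - y)) (t₀, x₀) := by fun_prop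
      exact ContinuousAt.comp (f := fun p : ℝ × Sp d => (p.1, p.2 - y))
        (h.continuousAt ht₀ (x₀ - y)) hcc
  have hdiff : Tendsto (fun p : ℝ × Lp ℝ (ENNReal.ofReal q) (volume : Measure (Sp d)) × Sp d =>
      convFun (k p.1) (p.2.1 - v₀ : Lp ℝ (ENNReal.ofReal q) (volume : Measure (Sp d))) p.2.2)
      (𝓝 (t₀, v₀, x₀)) (𝓝 0) := by
    obtain ⟨c, a, hc, ha, hev⟩ := h.eventually_le' ht₀
    obtain ⟨C, hC, hb⟩ := exists_abs_convFun_le (q := q) (isBddKernel_exp (d := d) hc ha)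
    have hlim : Tendsto (fun p : ℝ × Lp ℝ (ENNReal.ofReal q) (volume : Measure (Sp d)) × Sp d =>
        C * ‖p.2.1 - v₀‖) (𝓝 (t₀, v₀, x₀)) (𝓝 0) := by
      have : ContinuousAt (fun p : ℝ × Lp ℝ (ENNReal.ofReal q) (volume : Measure (Sp d)) × Sp d =>
        C * ‖p.2.1 - v₀‖) (t₀, v₀, x₀) := by fun_prop
      simpa [ContinuousAt] using this
    refine squeeze_zero_norm' ?_ hlim
    filter_upwards [continuous_fst.continuousAt.eventually hev] with p hp
    exact hb (k p.1) hp _ _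
  have hc2 : ContinuousAt (fun p : ℝ × Lp ℝ (ENNReal.ofReal q) (volume : Measure (Sp d)) × Sp d =>
      (p.1, p.2.2)) (t₀, v₀, x₀) := by fun_prop
  have h2 := ContinuousAt.comp (f := fun p : ℝ × Lp ℝ (ENNReal.ofReal q)
    (volume : Measure (Sp d)) × Sp d => (p.1, p.2.2)) hfix hc2
  have h3 := hdiff.add h2.tendsto
  rw [zero_add] at h3
  refine Tendsto.congr' ?_ h3
  filter_upwards [hpos] with p hp
  simp only [Function.comp]
  rw [convFun_congr_ae (Lp.coeFn_sub p.2.1 v₀), convFun_sub (h.isBddKernel hp) hq1 (Lp.memLp _)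
    (Lp.memLp _)]
  ring

/-- The Duhamel integral of convolution operators is computed pointwise. -/
theorem ae_duhamel_convLp (h : IsParabolicKernel k β) (hqr : q ≤ r)
    (hα : β + d / 4 * (1 / q - 1 / r) < 1) {T : ℝ}
    {g : ℝ → Lp ℝ (ENNReal.ofReal q) (volume : Measure (Sp d))} (hg : ContinuousOn g (Icc 0 T))
    {t : ℝ} (ht : t ∈ Icc 0 T) :
    (∀ᵐ x : Sp d, IntervalIntegrable (fun s => convFun (k (t - s)) (g s) x) volume 0 t) ∧
      (duhamel (fun s => convLp q r (k s)) g t :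
        Lp ℝ (ENNReal.ofReal r) (volume : Measure (Sp d))) =ᵐ[volume]
        fun x => ∫ s in (0 : ℝ)..t, convFun (k (t - s)) (g s) x := by
  obtain ⟨C, -, hC⟩ := h.exists_norm_convLp_le (q := q) (r := r) hqr T
  have hint := duhamel_intervalIntegrable hα
    ((h.continuousOn_convLp hqr).mono Ioc_subset_Ioi_self) hC hg ht
  rw [intervalIntegrable_iff_integrableOn_Ioo_of_le ht.1] at hint
  have hFc : ContinuousOn (Function.uncurry fun s x => convFun (k (t - s)) (g s) x)
      (Ioo 0 t ×ˢ (univ : Set (Sp d))) := by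
    rintro ⟨s, x⟩ ⟨hs, -⟩
    have hs' : s ∈ Icc 0 T := ⟨hs.1.le, hs.2.le.trans ht.2⟩
    have hgs : ContinuousAt g s :=
      hg.continuousAt (Icc_mem_nhds hs.1 (hs.2.trans_le ht.2))
    have hc : ContinuousAt (fun p : ℝ × Sp d => (t - p.1, g p.1, p.2)) (s, x) := by
      refine ContinuousAt.prodMk (by fun_prop) (ContinuousAt.prodMk ?_ (by fun_prop))
      exact ContinuousAt.comp (f := fun p : ℝ × Sp d => p.1) hgs (by fun_prop)
    exact (ContinuousAt.comp (f := fun p : ℝ × Sp d => (t - p.1, g p.1, p.2))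
      (h.continuousAt_convFun (sub_pos.2 hs.2) (g s) x) hc).continuousWithinAt
  have hFm := hFc.aestronglyMeasurable (measurableSet_Ioo.prod MeasurableSet.univ)
    (μ := (volume : Measure ℝ).prod (volume : Measure (Sp d)))
  rw [← Measure.prod_restrict, Measure.restrict_univ] at hFm
  have hae : ∀ᵐ s ∂(volume.restrict (Ioo 0 t)), convLp q r (k (t - s)) (g s) =ᵐ[volume]
      fun x => convFun (k (t - s)) (g s) x := by
    filter_upwards [ae_restrict_mem measurableSet_Ioo] with s hs
    exact coeFn_convLp (h.isBddKernel (sub_pos.2 hs.2)) hqr _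
  obtain ⟨h1, h2⟩ := Lp.ae_integrable_and_integral_eq hint hFm hae
  refine ⟨?_, ?_⟩
  · filter_upwards [h1] with x hx
    rwa [intervalIntegrable_iff_integrableOn_Ioo_of_le ht.1]
  · rw [duhamel, intervalIntegral.integral_of_le ht.1, integral_Ioc_eq_integral_Ioo]
    refine h2.trans (Eventually.of_forall fun x => ?_)
    simp only
    rw [intervalIntegral.integral_of_le ht.1, integral_Ioc_eq_integral_Ioo]

end IsParabolicKernel

end

/-! ### The truncated nonlinearity is bounded and globally Lipschitz. -/

noncomputable section

section Nonlinearity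

variable {d : ℕ} {p : ℝ}

theorem ballProj_of_le {N : ℕ} {v : L2p d p} (h : ‖v‖ ≤ N) : ballProj N v = v := if_pos h

theorem ballProj_of_lt {N : ℕ} {v : L2p d p} (h : N < ‖v‖) :
    ballProj N v = ((N : ℝ) / ‖v‖) • v := if_neg (not_le.2 h)

instance holderTriple_two_mul : ENNReal.HolderTriple (ENNReal.ofReal (2 * p))
    (ENNReal.ofReal (2 * p)) (ENNReal.ofReal p) where
  inv_add_inv_eq_inv := by
    rw [ENNReal.ofReal_mul zero_le_two, ENNReal.mul_inv (by simp) (by simp), ← add_mul]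
    simp [ENNReal.inv_two_add_inv_two]

/-- The square of an `L^{2p}` function as an element of `L^p`. -/
def sqLp (v : L2p d p) : Lp ℝ (ENNReal.ofReal p) (volume : Measure (Sp d)) :=
  (ContinuousLinearMap.mul ℝ ℝ).holder (ENNReal.ofReal p) v v

theorem coeFn_sqLp (v : L2p d p) : sqLp v =ᵐ[volume] fun x => v x ^ 2 := by
  filter_upwards [(ContinuousLinearMap.mul ℝ ℝ).coeFn_holder (r := ENNReal.ofReal p) v v] with x hx
  rw [sqLp, hx, ContinuousLinearMap.mul_apply', pow_two]

variable [hp : Fact (1 ≤ p)]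

instance fact_one_le_ofReal : Fact (1 ≤ ENNReal.ofReal p) := ⟨ENNReal.one_le_ofReal.2 hp.out⟩

theorem norm_ballProj_le (N : ℕ) (v : L2p d p) : ‖ballProj N v‖ ≤ N := by
  rcases le_or_gt ‖v‖ N with h | h
  · rwa [ballProj_of_le h]
  · have hv : 0 < ‖v‖ := (Nat.cast_nonneg N).trans_lt h
    rw [ballProj_of_lt h, norm_smul, Real.norm_of_nonneg (by positivity),
      div_mul_cancel₀ _ hv.ne']

/-- The constant 2 comes from the triangle inequality alone, without any Hilbert structure. Outside
the ball the projection moves v radially by ‖v‖ - N, which is at most ‖v - w‖ when ‖w‖ ≤ N. -/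
theorem norm_ballProj_sub_le (N : ℕ) (v w : L2p d p) :
    ‖ballProj N v - ballProj N w‖ ≤ 2 * ‖v - w‖ := by
  have key : ∀ v w : L2p d p, N < ‖v‖ → ‖w‖ ≤ N → ‖ballProj N v - w‖ ≤ 2 * ‖v - w‖ := by
    intro v w hv hw
    have hv0 : 0 < ‖v‖ := (Nat.cast_nonneg N).trans_lt hv
    have h1 : ‖ballProj N v - v‖ = ‖v‖ - N := by
      have : ballProj N v - v = -((1 - (N : ℝ) / ‖v‖) • v) := by
        rw [ballProj_of_lt hv, sub_smul, one_smul, neg_sub]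
      rw [this, norm_neg, norm_smul, Real.norm_of_nonneg, sub_mul, div_mul_cancel₀ _ hv0.ne',
        one_mul]
      rw [sub_nonneg, div_le_one hv0]
      exact hv.le
    have h2 := norm_sub_norm_le v w
    have h3 := norm_sub_le_norm_sub_add_norm_sub (ballProj N v) v w
    linarith
  rcases le_or_gt ‖v‖ N with hv | hv <;> rcases le_or_gt ‖w‖ N with hw | hw
  · rw [ballProj_of_le hv, ballProj_of_le hw]
    linarith [norm_nonneg (v - w)]
  · rw [ballProj_of_le hv, norm_sub_rev, norm_sub_rev v]
    exact key w v hw hv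
  · rw [ballProj_of_le hw]
    exact key v w hv hw
  · have hv0 : 0 < ‖v‖ := (Nat.cast_nonneg N).trans_lt hv
    have hw0 : 0 < ‖w‖ := (Nat.cast_nonneg N).trans_lt hw
    have e : ballProj N v - ballProj N w =
        ((N : ℝ) / ‖v‖) • (v - w) + ((N : ℝ) / ‖v‖ - N / ‖w‖) • w := by
      rw [ballProj_of_lt hv, ballProj_of_lt hw]
      module
    have h1 : (N : ℝ) / ‖v‖ ≤ 1 := (div_le_one hv0).2 hv.le
    have h2 : |(N : ℝ) / ‖v‖ - N / ‖w‖| * ‖w‖ = (N : ℝ) / ‖v‖ * |‖w‖ - ‖v‖| := by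
      have : (N : ℝ) / ‖v‖ - N / ‖w‖ = (N : ℝ) / ‖v‖ * (‖w‖ - ‖v‖) / ‖w‖ := by
        field_simp
      rw [this, abs_div, abs_mul, abs_of_pos hw0, abs_of_nonneg (by positivity : 0 ≤ (N : ℝ) / ‖v‖)]
      field_simp
    have h3 := abs_norm_sub_norm_le w v
    rw [norm_sub_rev] at h3
    have hn := norm_nonneg (v - w)
    have hN : 0 ≤ (N : ℝ) / ‖v‖ := by positivity
    rw [e]
    refine (norm_add_le _ _).trans ?_
    rw [norm_smul, norm_smul, Real.norm_of_nonneg hN, Real.norm_eq_abs, h2]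
    nlinarith

theorem norm_holder_mul_le (v w : L2p d p) :
    ‖(ContinuousLinearMap.mul ℝ ℝ).holder (ENNReal.ofReal p) v w‖ ≤ ‖v‖ * ‖w‖ := by
  refine ((ContinuousLinearMap.mul ℝ ℝ).norm_holder_apply_apply_le v w).trans ?_
  have h := ContinuousLinearMap.opNorm_mul_le ℝ ℝ
  have : 0 ≤ ‖v‖ * ‖w‖ := by positivity
  rw [mul_assoc]
  exact mul_le_of_le_one_left this h

theorem norm_sqLp_le (v : L2p d p) : ‖sqLp v‖ ≤ ‖v‖ ^ 2 := by
  rw [pow_two]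
  exact norm_holder_mul_le v v

/-- Factor v² - w² = (v - w)v + w(v - w) and apply Hölder. Squaring is only locally Lipschitz;
truncation bounds the first factor by 2N. -/
theorem norm_sqLp_sub_le (v w : L2p d p) : ‖sqLp v - sqLp w‖ ≤ (‖v‖ + ‖w‖) * ‖v - w‖ := by
  set B := ContinuousLinearMap.mul ℝ ℝ
  have e : sqLp v - sqLp w = B.holder (ENNReal.ofReal p) (v - w) v +
      B.holder (ENNReal.ofReal p) w (v - w) := by
    have h1 := B.holder_add_left (r := ENNReal.ofReal p) (v - w) w v
    have h2 := B.holder_add_right (r := ENNReal.ofReal p) w (v - w) w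
    rw [sub_add_cancel] at h1 h2
    rw [sqLp, sqLp, h1, h2]
    abel
  rw [e]
  refine (norm_add_le _ _).trans ?_
  linarith [norm_holder_mul_le (v - w) v, norm_holder_mul_le w (v - w)]

theorem norm_sqLp_ballProj_le (N : ℕ) (v : L2p d p) : ‖sqLp (ballProj N v)‖ ≤ (N : ℝ) ^ 2 :=
  (norm_sqLp_le _).trans (pow_le_pow_left₀ (norm_nonneg _) (norm_ballProj_le N v) 2)

theorem norm_sqLp_ballProj_sub_le (N : ℕ) (v w : L2p d p) :
    ‖sqLp (ballProj N v) - sqLp (ballProj N w)‖ ≤ 4 * N * ‖v - w‖ := by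
  refine (norm_sqLp_sub_le _ _).trans ?_
  have h1 := norm_ballProj_le N v
  have h2 := norm_ballProj_le N w
  calc _ ≤ (N + N : ℝ) * (2 * ‖v - w‖) := by
        gcongr
        exact norm_ballProj_sub_le N v w
    _ = _ := by ring

/-- The truncated nonlinearity `v ↦ (I_N v, (I_N v)²)`. -/
def truncNonlin (N : ℕ) (v : L2p d p) :
    L2p d p × Lp ℝ (ENNReal.ofReal p) (volume : Measure (Sp d)) :=
  (ballProj N v, sqLp (ballProj N v))

theorem lipschitzWith_truncNonlin (N : ℕ) :
    LipschitzWith (2 + 4 * N) (truncNonlin (d := d) (p := p) N) := by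
  refine LipschitzWith.of_dist_le_mul fun v w => ?_
  rw [dist_eq_norm, dist_eq_norm, Prod.norm_def]
  have hn := norm_nonneg (v - w)
  have hN : (0 : ℝ) ≤ N := Nat.cast_nonneg N
  push_cast
  refine max_le ?_ ?_
  · exact (norm_ballProj_sub_le N v w).trans (by nlinarith [mul_nonneg hN hn])
  · exact (norm_sqLp_ballProj_sub_le N v w).trans (by nlinarith)

end Nonlinearity

/-! ### Pointwise form of the convolution terms, and continuity of the free evolution. -/

section Mild

open Filter Topology

variable {d : ℕ} {k : ℝ → Sp d → ℝ} {β : ℝ} {q r : ℝ} [hq : Fact (1 ≤ ENNReal.ofReal q)]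
  [hr : Fact (1 ≤ ENNReal.ofReal r)]

theorem integral_kernel_eq_convFun {G : ℝ → Sp d → Sp d → ℝ}
    (hG : ∀ t, 0 < t → ∀ x y, G t x y = k t (x - y)) {v u : Sp d → ℝ} (h : v =ᵐ[volume] u)
    {t : ℝ} (ht : 0 < t) (x : Sp d) : ∫ y, G t x y * u y = convFun (k t) v x := by
  rw [convFun_congr_ae h, convFun]
  simp only [hG t ht]

theorem integrable_kernel {G : ℝ → Sp d → Sp d → ℝ} (h : IsParabolicKernel k β)
    (hG : ∀ t, 0 < t → ∀ x y, G t x y = k t (x - y))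
    {v : Lp ℝ (ENNReal.ofReal q) (volume : Measure (Sp d))} {u : Sp d → ℝ} (hu : v =ᵐ[volume] u)
    {t : ℝ} (ht : 0 < t) (x : Sp d) : Integrable fun y => G t x y * u y := by
  refine (integrable_convFun (h.isBddKernel ht) (ENNReal.one_le_ofReal.1 hq.out)
    (Lp.memLp v) x).congr ?_
  filter_upwards [hu] with y hy
  rw [hG t ht, hy]

/-- Existence and value of the space-time convolution with a parabolic kernel. -/
theorem ae_spaceTimeConv {G : ℝ → Sp d → Sp d → ℝ} (h : IsParabolicKernel k β)
    (hG : ∀ t, 0 < t → ∀ x y, G t x y = k t (x - y)) (hqr : q ≤ r)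
    (hα : β + d / 4 * (1 / q - 1 / r) < 1) {T : ℝ}
    {g : ℝ → Lp ℝ (ENNReal.ofReal q) (volume : Measure (Sp d))} (hg : ContinuousOn g (Icc 0 T))
    {u : ℝ → Sp d → ℝ} (hu : ∀ s, g s =ᵐ[volume] u s) {t : ℝ} (ht : t ∈ Icc 0 T) :
    (∀ᵐ x, SpaceTimeConvExists G u t x) ∧
      (duhamel (fun s => convLp q r (k s)) g t :
        Lp ℝ (ENNReal.ofReal r) (volume : Measure (Sp d))) =ᵐ[volume] spaceTimeConv G u t := by
  obtain ⟨h1, h2⟩ := h.ae_duhamel_convLp hqr hα hg ht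
  -- The kernels agree only at positive times, so the endpoint s = t has to be excluded; it is a
  -- null set.
  have e : ∀ x, ∀ s ∈ Ioo 0 t, convFun (k (t - s)) (g s) x = ∫ y, G (t - s) x y * u s y :=
    fun x s hs => (integral_kernel_eq_convFun hG (hu s) (sub_pos.2 hs.2) x).symm
  refine ⟨?_, ?_⟩
  · filter_upwards [h1] with x hx
    refine ⟨fun s hs => integrable_kernel h hG (hu s) (sub_pos.2 hs.2) x, ?_⟩
    rw [intervalIntegrable_iff_integrableOn_Ioo_of_le ht.1] at hx ⊢
    exact hx.congr_fun (e x) measurableSet_Ioo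
  · refine h2.trans (Eventually.of_forall fun x => ?_)
    simp only
    rw [spaceTimeConv, intervalIntegral.integral_of_le ht.1, integral_Ioc_eq_integral_Ioo,
      intervalIntegral.integral_of_le ht.1, integral_Ioc_eq_integral_Ioo]
    exact setIntegral_congr_fun measurableSet_Ioo (e x)

variable (d) in
/-- The L-KS kernel as a function of time and displacement. -/
def lks : ℝ → Sp d → ℝ := mixIntegral gaussMix

/-- The derivative of the L-KS kernel as a function of time and displacement. -/
def lksDeriv (j : Fin d) : ℝ → Sp d → ℝ :=
  mixIntegral (gaussMixDeriv (EuclideanSpace.single j (1 : ℝ)))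

theorem isParabolicKernel_lks : IsParabolicKernel (lks d) 0 := isParabolicKernel_gaussMix

theorem isParabolicKernel_lksDeriv (j : Fin d) : IsParabolicKernel (lksDeriv j) (1 / 4) :=
  isParabolicKernel_gaussMixDeriv (by simp)

/-- The evolution of the initial datum under the L-KS semigroup. -/
def lksEvol (u₀ : Lp ℝ (ENNReal.ofReal r) (volume : Measure (Sp d))) (t : ℝ) :
    Lp ℝ (ENNReal.ofReal r) (volume : Measure (Sp d)) :=
  if t = 0 then u₀ else convLp r r (lks d t) u₀

theorem lksEvol_of_pos (u₀ : Lp ℝ (ENNReal.ofReal r) (volume : Measure (Sp d))) {t : ℝ}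
    (ht : 0 < t) : lksEvol u₀ t = convLp r r (lks d t) u₀ := if_neg ht.ne'

theorem coeFn_lksEvol (u₀ : Lp ℝ (ENNReal.ofReal r) (volume : Measure (Sp d))) {t : ℝ}
    (ht : 0 ≤ t) : lksEvol u₀ t =ᵐ[volume] initConv u₀ t := by
  rcases ht.eq_or_lt with h | h
  · subst h
    refine Eventually.of_forall fun x => ?_
    simp [lksEvol, initConv]
  · rw [lksEvol_of_pos u₀ h]
    refine (coeFn_convLp (isParabolicKernel_lks.isBddKernel h) le_rfl u₀).trans
      (Eventually.of_forall fun x => ?_)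
    rw [initConv, if_neg h.ne']
    exact (integral_kernel_eq_convFun (fun t ht => lksKernel_eq_mixIntegral ht)
      (EventuallyEq.refl _ _) h x).symm

theorem continuousOn_lksEvol (u₀ : Lp ℝ (ENNReal.ofReal r) (volume : Measure (Sp d))) :
    ContinuousOn (lksEvol u₀) (Ici 0) := by
  intro t ht
  rcases (mem_Ici.1 ht).eq_or_lt with h | h
  · subst h
    have hmass : Tendsto (fun t => ∫ z, lks d t z) (𝓝[>] 0) (𝓝 1) := by
      have h1 : Tendsto (fun t : ℝ => Real.exp (-(t / 2))) (𝓝[>] 0) (𝓝 1) := by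
        have : ContinuousAt (fun t : ℝ => Real.exp (-(t / 2))) 0 := by fun_prop
        simpa using this.tendsto.mono_left nhdsWithin_le_nhds
      refine h1.congr' ?_
      filter_upwards [self_mem_nhdsWithin] with t ht
      exact (integral_mixIntegral_gaussMix ht).symm
    have h2 := isParabolicKernel_lks.tendsto_convLp_zero hmass u₀
    rw [← Ioi_insert, continuousWithinAt_insert_self, ContinuousWithinAt]
    have h3 : lksEvol u₀ 0 = u₀ := if_pos rfl
    rw [h3]
    refine h2.congr' ?_
    filter_upwards [self_mem_nhdsWithin] with t ht
    exact (lksEvol_of_pos u₀ ht).symm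
  · refine ContinuousAt.continuousWithinAt ?_
    have h1 : ContinuousAt (fun t => convLp r r (lks d t) u₀) t :=
      ((isParabolicKernel_lks.continuousOn_convLp le_rfl).continuousAt
        (Ioi_mem_nhds h)).clm_apply continuousAt_const
    refine h1.congr ?_
    filter_upwards [Ioi_mem_nhds h] with s hs
    exact (lksEvol_of_pos u₀ hs).symm

end Mild

end

/-! ### The mild equation as a Volterra equation in L^{2p}. -/

noncomputable section

section MildSolution

open Filter Topology

section PairOp

variable {X Y E : Type*} [NormedAddCommGroup X] [NormedSpace ℝ X] [NormedAddCommGroup Y]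
  [NormedSpace ℝ Y] [NormedAddCommGroup E] [NormedSpace ℝ E]

/-- The operator `(x, y) ↦ (A x + B y) / 2`. -/
def pairOp (A : X →L[ℝ] E) (B : Y →L[ℝ] E) : X × Y →L[ℝ] E :=
  (1 / 2 : ℝ) • A.coprod B

theorem pairOp_apply (A : X →L[ℝ] E) (B : Y →L[ℝ] E) (v : X × Y) :
    pairOp A B v = (1 / 2 : ℝ) • A v.1 + (1 / 2 : ℝ) • B v.2 := by
  simp [pairOp]

theorem norm_pairOp_le (A : X →L[ℝ] E) (B : Y →L[ℝ] E) : ‖pairOp A B‖ ≤ ‖A‖ + ‖B‖ := by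
  refine ContinuousLinearMap.opNorm_le_bound _ (by positivity) fun v => ?_
  have h1 := (A.le_opNorm v.1).trans (mul_le_mul_of_nonneg_left (norm_fst_le v) (norm_nonneg A))
  have h2 := (B.le_opNorm v.2).trans (mul_le_mul_of_nonneg_left (norm_snd_le v) (norm_nonneg B))
  rw [pairOp_apply]
  refine (norm_add_le _ _).trans ?_
  rw [norm_smul, norm_smul, Real.norm_of_nonneg (by norm_num : (0 : ℝ) ≤ 1 / 2)]
  linarith [norm_nonneg (A v.1), norm_nonneg (B v.2)]

theorem continuousOn_pairOp {A : ℝ → X →L[ℝ] E} {B : ℝ → Y →L[ℝ] E} {S : Set ℝ}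
    (hA : ContinuousOn A S) (hB : ContinuousOn B S) :
    ContinuousOn (fun s => pairOp (A s) (B s)) S := by
  have e : ∀ s, pairOp (A s) (B s) = (1 / 2 : ℝ) • ((A s).comp (ContinuousLinearMap.fst ℝ X Y) +
      (B s).comp (ContinuousLinearMap.snd ℝ X Y)) := by
    intro s
    ext v <;> simp [pairOp]
  have hA' : ContinuousOn (fun s => (A s).comp (ContinuousLinearMap.fst ℝ X Y)) S :=
    hA.clm_comp continuousOn_const
  have hB' : ContinuousOn (fun s => (B s).comp (ContinuousLinearMap.snd ℝ X Y)) S :=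
    hB.clm_comp continuousOn_const
  simp only [e]
  exact (hA'.add hB').const_smul (1 / 2 : ℝ)

theorem duhamel_pairOp {ι : Type*} [Fintype ι] {A : ℝ → X →L[ℝ] E} {B : ι → ℝ → Y →L[ℝ] E}
    {f : ℝ → X} {g : ℝ → Y} {t : ℝ}
    (hA : IntervalIntegrable (fun s => A (t - s) (f s)) volume 0 t)
    (hB : ∀ j, IntervalIntegrable (fun s => B j (t - s) (g s)) volume 0 t) :
    duhamel (fun s => pairOp (A s) (∑ j, B j s)) (fun s => (f s, g s)) t =
      (1 / 2 : ℝ) • duhamel A f t + (1 / 2 : ℝ) • ∑ j, duhamel (B j) g t := by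
  have hs : IntervalIntegrable (fun s => ∑ j, B j (t - s) (g s)) volume 0 t := by
    have := IntervalIntegrable.sum Finset.univ fun j _ => hB j
    refine this.congr fun s _ => ?_
    simp
  have e : (1 / 2 : ℝ) • (∫ s in (0 : ℝ)..t, A (t - s) (f s)) +
      (1 / 2 : ℝ) • (∫ s in (0 : ℝ)..t, ∑ j, B j (t - s) (g s)) =
      ∫ s in (0 : ℝ)..t, ((1 / 2 : ℝ) • A (t - s) (f s) +
        (1 / 2 : ℝ) • ∑ j, B j (t - s) (g s)) := by
    rw [← intervalIntegral.integral_smul, ← intervalIntegral.integral_smul]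
    exact (intervalIntegral.integral_add (hA.smul (1 / 2 : ℝ)) (hs.smul (1 / 2 : ℝ))).symm
  simp only [duhamel]
  rw [← intervalIntegral.integral_finsetSum fun j _ => hB j, e]
  refine intervalIntegral.integral_congr fun s _ => ?_
  simp [pairOp_apply]

end PairOp

variable {d : ℕ} {p : ℝ}

theorem Lp_coeFn_sum {ι : Type*} (s : Finset ι) (f : ι → L2p d p) :
    (∑ i ∈ s, f i : L2p d p) =ᵐ[volume] fun x => ∑ i ∈ s, f i x := by
  classical
  induction s using Finset.induction_on with
  | empty =>
    simp only [Finset.sum_empty]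
    exact Lp.coeFn_zero _ _ _
  | insert a s ha ih =>
    simp only [Finset.sum_insert ha]
    filter_upwards [Lp.coeFn_add (f a) (∑ i ∈ s, f i), ih] with x h1 h2
    rw [h1, Pi.add_apply, h2]

theorem lks_exponent (d : ℕ) (p : ℝ) :
    (0 : ℝ) + d / 4 * (1 / (2 * p) - 1 / (2 * p)) = 0 := by ring

theorem lksDeriv_exponent (hp : 1 ≤ p) (d : ℕ) :
    (1 / 4 : ℝ) + d / 4 * (1 / p - 1 / (2 * p)) = 1 / 4 + d / (8 * p) := by
  have : p ≠ 0 := by linarith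
  field_simp
  ring

theorem lksDeriv_exponent_lt (hp : 1 ≤ p) (hdp : (d : ℝ) < 6 * p) :
    (1 / 4 : ℝ) + d / (8 * p) < 1 := by
  have : (d : ℝ) / (8 * p) < 3 / 4 := by
    rw [div_lt_iff₀ (by linarith)]
    linarith
  linarith

theorem one_sub_lksDeriv_exponent (hp : 1 ≤ p) (d : ℕ) :
    1 - (1 / 4 + d / (8 * p) : ℝ) = (6 * p - d) / (8 * p) := by
  have : p ≠ 0 := by linarith
  field_simp
  ring

theorem le_two_mul_of_one_le (hp : 1 ≤ p) : p ≤ 2 * p := by linarith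

variable [hp : Fact (1 ≤ p)]

/-- The L-KS semigroup at time `s` as an operator on `L^{2p}`. -/
def semigroupOp (d : ℕ) (p : ℝ) [Fact (1 ≤ p)] (s : ℝ) : L2p d p →L[ℝ] L2p d p :=
  convLp (2 * p) (2 * p) (lks d s)

/-- The convolution with the derivative of the L-KS kernel at time `s`, from `L^p` to `L^{2p}`. -/
def burgersOp (p : ℝ) [Fact (1 ≤ p)] (j : Fin d) (s : ℝ) :
    Lp ℝ (ENNReal.ofReal p) (volume : Measure (Sp d)) →L[ℝ] L2p d p :=
  convLp p (2 * p) (lksDeriv j s)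

theorem continuousOn_semigroupOp (T : ℝ) : ContinuousOn (semigroupOp d p) (Ioc 0 T) :=
  (isParabolicKernel_lks.continuousOn_convLp le_rfl).mono Ioc_subset_Ioi_self

theorem continuousOn_burgersOp (j : Fin d) (T : ℝ) : ContinuousOn (burgersOp p j) (Ioc 0 T) :=
  ((isParabolicKernel_lksDeriv j).continuousOn_convLp (le_two_mul_of_one_le hp.out)).mono
    Ioc_subset_Ioi_self

theorem exists_norm_semigroupOp_le (d : ℕ) (p : ℝ) [hp : Fact (1 ≤ p)] (T : ℝ) :
    ∃ C, 0 ≤ C ∧ ∀ s ∈ Ioc 0 T, ‖semigroupOp d p s‖ ≤ C * s ^ (-0 : ℝ) := by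
  obtain ⟨C, hC, h⟩ := (isParabolicKernel_lks (d := d)).exists_norm_convLp_le (q := 2 * p)
    (r := 2 * p) le_rfl T
  rw [lks_exponent] at h
  exact ⟨C, hC, h⟩

theorem exists_norm_burgersOp_le (d : ℕ) (p : ℝ) [hp : Fact (1 ≤ p)] (T : ℝ) :
    ∃ C, 0 ≤ C ∧ ∀ j : Fin d, ∀ s ∈ Ioc 0 T,
      ‖burgersOp p j s‖ ≤ C * s ^ (-(1 / 4 + d / (8 * p)) : ℝ) := by
  have h := fun j : Fin d => (isParabolicKernel_lksDeriv j).exists_norm_convLp_le (q := p)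
    (r := 2 * p) (le_two_mul_of_one_le hp.out) T
  simp only [lksDeriv_exponent hp.out] at h
  choose C hC hb using h
  refine ⟨∑ j, C j, Finset.sum_nonneg fun j _ => hC j, fun j s hs => (hb j s hs).trans ?_⟩
  exact mul_le_mul_of_nonneg_right (Finset.single_le_sum (fun i _ => hC i) (Finset.mem_univ j))
    (Real.rpow_nonneg hs.1.le _)

/-- The operator kernel of the mild equation, acting on pairs in `L^{2p} × L^p`. -/
def mildOp (d : ℕ) (p : ℝ) [Fact (1 ≤ p)] (s : ℝ) :
    L2p d p × Lp ℝ (ENNReal.ofReal p) (volume : Measure (Sp d)) →L[ℝ] L2p d p :=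
  pairOp (semigroupOp d p s) (∑ j, burgersOp p j s)

theorem continuousOn_mildOp (T : ℝ) : ContinuousOn (mildOp d p) (Ioc 0 T) :=
  continuousOn_pairOp (continuousOn_semigroupOp T)
    (continuousOn_finsetSum _ fun j _ => continuousOn_burgersOp j T)

theorem exists_norm_mildOp_le (d : ℕ) (p : ℝ) [hp : Fact (1 ≤ p)] {T : ℝ} (hT : 0 < T) :
    ∃ C, 0 ≤ C ∧ ∀ s ∈ Ioc 0 T, ‖mildOp d p s‖ ≤ C * s ^ (-(1 / 4 + d / (8 * p)) : ℝ) := by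
  obtain ⟨C₁, hC₁, h₁⟩ := exists_norm_semigroupOp_le d p T
  obtain ⟨C₂, hC₂, h₂⟩ := exists_norm_burgersOp_le d p T
  have hp0 : 0 < p := by linarith [hp.out]
  set α : ℝ := 1 / 4 + d / (8 * p)
  have hα : 0 ≤ α := by positivity
  -- The semigroup part is bounded, and 1 ≤ T^α s^{-α} on (0, T] puts it under the same singular
  -- weight as the d gradient terms.
  refine ⟨C₁ * T ^ α + d * C₂, by positivity, fun s hs => ?_⟩
  have hs0 := hs.1
  have e1 : ‖semigroupOp d p s‖ ≤ C₁ * T ^ α * s ^ (-α) := by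
    refine (h₁ s hs).trans ?_
    rw [neg_zero, Real.rpow_zero, mul_one, mul_assoc]
    refine le_mul_of_one_le_right hC₁ ?_
    rw [Real.rpow_neg hs0.le, ← div_eq_mul_inv, ← Real.div_rpow hT.le hs0.le]
    exact Real.one_le_rpow ((one_le_div hs0).2 hs.2) hα
  have e2 : ‖∑ j, burgersOp (d := d) p j s‖ ≤ d * C₂ * s ^ (-α) := by
    refine (norm_sum_le _ _).trans ((Finset.sum_le_sum fun j _ => h₂ j s hs).trans (le_of_eq ?_))
    simp [mul_assoc]
  refine (norm_pairOp_le _ _).trans ((add_le_add e1 e2).trans (le_of_eq ?_))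
  ring

variable {T : ℝ} {N : ℕ}

theorem continuousOn_ballProj {U : ℝ → L2p d p} (hU : ContinuousOn U (Icc 0 T)) :
    ContinuousOn (fun s => ballProj N (U s)) (Icc 0 T) :=
  continuous_fst.comp_continuousOn ((lipschitzWith_truncNonlin N).continuous.comp_continuousOn hU)

theorem continuousOn_sqLp_ballProj {U : ℝ → L2p d p} (hU : ContinuousOn U (Icc 0 T)) :
    ContinuousOn (fun s => sqLp (ballProj N (U s))) (Icc 0 T) :=
  continuous_snd.comp_continuousOn ((lipschitzWith_truncNonlin N).continuous.comp_continuousOn hU)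

theorem duhamel_mildOp (hdp : (d : ℝ) < 6 * p) {U : ℝ → L2p d p}
    (hU : ContinuousOn U (Icc 0 T)) {t : ℝ} (ht : t ∈ Icc 0 T) :
    duhamel (mildOp d p) (fun s => truncNonlin N (U s)) t =
      (1 / 2 : ℝ) • duhamel (semigroupOp d p) (fun s => ballProj N (U s)) t +
      (1 / 2 : ℝ) • ∑ j : Fin d, duhamel (burgersOp p j) (fun s => sqLp (ballProj N (U s))) t := by
  obtain ⟨C₁, -, h₁⟩ := exists_norm_semigroupOp_le d p T
  obtain ⟨C₂, -, h₂⟩ := exists_norm_burgersOp_le d p T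
  have i₁ := duhamel_intervalIntegrable zero_lt_one (continuousOn_semigroupOp T) h₁
    (continuousOn_ballProj (N := N) hU) ht
  have i₂ := fun j : Fin d => duhamel_intervalIntegrable (lksDeriv_exponent_lt hp.out hdp)
    (continuousOn_burgersOp j T) (h₂ j) (continuousOn_sqLp_ballProj (N := N) hU) ht
  exact duhamel_pairOp i₁ i₂

theorem ae_linear_term {U : ℝ → L2p d p} (hU : ContinuousOn U (Icc 0 T)) {t : ℝ}
    (ht : t ∈ Icc 0 T) :
    (∀ᵐ x, SpaceTimeConvExists lksKernel (fun s y => ballProj N (U s) y) t x) ∧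
      (duhamel (semigroupOp d p) (fun s => ballProj N (U s)) t : L2p d p) =ᵐ[volume]
        spaceTimeConv lksKernel (fun s y => ballProj N (U s) y) t :=
  ae_spaceTimeConv isParabolicKernel_lks (fun t ht => lksKernel_eq_mixIntegral ht) le_rfl
    (by rw [lks_exponent]; exact zero_lt_one) (continuousOn_ballProj hU)
    (fun s => EventuallyEq.refl _ _) ht

theorem ae_burgers_term (hdp : (d : ℝ) < 6 * p) {U : ℝ → L2p d p}
    (hU : ContinuousOn U (Icc 0 T)) (j : Fin d) {t : ℝ} (ht : t ∈ Icc 0 T) :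
    (∀ᵐ x, SpaceTimeConvExists (lksKernelDeriv j) (fun s y => (ballProj N (U s) y) ^ 2) t x) ∧
      (duhamel (burgersOp p j) (fun s => sqLp (ballProj N (U s))) t : L2p d p) =ᵐ[volume]
        spaceTimeConv (lksKernelDeriv j) (fun s y => (ballProj N (U s) y) ^ 2) t :=
  ae_spaceTimeConv (isParabolicKernel_lksDeriv j) (fun t ht => lksKernelDeriv_eq_mixIntegral j ht)
    (le_two_mul_of_one_le hp.out)
    (by rw [lksDeriv_exponent hp.out]; exact lksDeriv_exponent_lt hp.out hdp)
    (continuousOn_sqLp_ballProj hU) (fun s => coeFn_sqLp _) ht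

/-- The right-hand side of the mild equation, pointwise and as an element of `L^{2p}`. -/
theorem ae_mild_rhs (hdp : (d : ℝ) < 6 * p) (u₀ : L2p d p) {U : ℝ → L2p d p}
    (hU : ContinuousOn U (Icc 0 T)) {t : ℝ} (ht : t ∈ Icc 0 T) :
    (lksEvol u₀ t + duhamel (mildOp d p) (fun s => truncNonlin N (U s)) t : L2p d p) =ᵐ[volume]
      fun x => initConv u₀ t x
        + (1 / 2) * spaceTimeConv lksKernel (fun s y => ballProj N (U s) y) t x
        + (1 / 2) * ∑ l : Fin d,
            spaceTimeConv (lksKernelDeriv l) (fun s y => (ballProj N (U s) y) ^ 2) t x := by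
  rw [duhamel_mildOp hdp hU ht, ← add_assoc]
  set D₁ := duhamel (semigroupOp d p) (fun s => ballProj N (U s)) t
  set D₂ := fun j : Fin d => duhamel (burgersOp p j) (fun s => sqLp (ballProj N (U s))) t
  have h2 : ∀ᵐ x, ∀ j : Fin d, D₂ j x =
      spaceTimeConv (lksKernelDeriv j) (fun s y => (ballProj N (U s) y) ^ 2) t x :=
    ae_all_iff.2 fun j => (ae_burgers_term hdp hU j ht).2
  filter_upwards [Lp.coeFn_add (lksEvol u₀ t + (1 / 2 : ℝ) • D₁) ((1 / 2 : ℝ) • ∑ j, D₂ j),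
    Lp.coeFn_add (lksEvol u₀ t) ((1 / 2 : ℝ) • D₁), Lp.coeFn_smul (1 / 2 : ℝ) D₁,
    Lp.coeFn_smul (1 / 2 : ℝ) (∑ j, D₂ j), Lp_coeFn_sum Finset.univ D₂, coeFn_lksEvol u₀ ht.1,
    (ae_linear_term hU ht).2, h2] with x e1 e2 e3 e4 e5 e6 e7 e8
  rw [e1, Pi.add_apply, e2, Pi.add_apply, e3, e4, Pi.smul_apply, Pi.smul_apply, e5, e6, e7]
  simp only [e8, smul_eq_mul]

/-- Continuity of U alone yields every integrability clause and the a.e. identification of the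
right-hand sides, so the two formulations differ only by passing between a.e. equality and equality
in L^{2p}. -/
theorem isTruncatedMildSolution_iff (hdp : (d : ℝ) < 6 * p) (u₀ : L2p d p) (U : ℝ → L2p d p) :
    IsTruncatedMildSolution T N u₀ U ↔ ContinuousOn U (Icc 0 T) ∧ ∀ t ∈ Icc 0 T,
      U t = lksEvol u₀ t + duhamel (mildOp d p) (fun s => truncNonlin N (U s)) t := by
  refine ⟨fun h => ⟨h.continuousOn, fun t ht => ?_⟩, fun h => ⟨h.1, ?_, ?_, ?_, ?_⟩⟩
  · exact Lp.ext (EventuallyEq.trans (h.mild_eq t ht) (ae_mild_rhs hdp u₀ h.continuousOn ht).symm)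
  · exact fun t ht => Eventually.of_forall fun x => integrable_kernel isParabolicKernel_lks
      (fun t ht => lksKernel_eq_mixIntegral ht) (EventuallyEq.refl _ _) ht.1 x
  · exact fun t ht => (ae_linear_term h.1 ht).1
  · exact fun t ht => ae_all_iff.2 fun j => (ae_burgers_term hdp h.1 j ht).1
  · intro t ht
    rw [h.2 t ht]
    exact ae_mild_rhs hdp u₀ h.1 ht

/-- The bound concerns the right-hand side for an arbitrary continuous path: after truncation its
size no longer depends on U, so the constant is chosen before u₀, N and U. -/
theorem exists_norm_mild_rhs_le (hdp : (d : ℝ) < 6 * p) (hT : 0 < T) :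
    ∃ C : ℝ, 0 < C ∧ ∀ (u₀ : L2p d p) (N : ℕ) (U : ℝ → L2p d p), ContinuousOn U (Icc 0 T) →
      ∀ t ∈ Icc 0 T, ‖lksEvol u₀ t + duhamel (mildOp d p) (fun s => truncNonlin N (U s)) t‖ ≤
        C * (‖u₀‖ + T * N + d * (N : ℝ) ^ 2 * T ^ ((6 * p - d) / (8 * p))) := by
  obtain ⟨C₁, hC₁, h₁⟩ := exists_norm_semigroupOp_le d p T
  obtain ⟨C₂, hC₂, h₂⟩ := exists_norm_burgersOp_le d p T
  have hα := lksDeriv_exponent_lt hp.out hdp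
  have hγ := one_sub_lksDeriv_exponent hp.out d
  set α : ℝ := 1 / 4 + d / (8 * p)
  have hα' : 0 < 1 - α := by linarith
  -- The summand 1 covers t = 0, where the free evolution is u₀ itself; 1/(1 - α) comes from
  -- integrating the singularity s^{-α}.
  refine ⟨1 + C₁ + C₂ / (1 - α), by positivity, fun u₀ N U hU t ht => ?_⟩
  rw [duhamel_mildOp hdp hU ht, ← hγ]
  have b0 : ‖lksEvol u₀ t‖ ≤ (1 + C₁) * ‖u₀‖ := by
    have hn := norm_nonneg u₀
    rcases ht.1.eq_or_lt with h | h
    · subst h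
      rw [lksEvol, if_pos rfl]
      nlinarith
    · rw [lksEvol_of_pos u₀ h]
      have e := (semigroupOp d p t).le_of_opNorm_le (h₁ t ⟨h, ht.2⟩) u₀
      rw [neg_zero, Real.rpow_zero, mul_one] at e
      exact e.trans (by nlinarith)
  have b1 : ‖duhamel (semigroupOp d p) (fun s => ballProj N (U s)) t‖ ≤ C₁ * (T * N) := by
    refine (norm_duhamel_le zero_lt_one h₁ (fun r _ => norm_ballProj_le N (U r)) ht).trans ?_
    rw [sub_zero, Real.rpow_one, div_one, mul_assoc, mul_comm (N : ℝ)]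
    have := ht.2
    gcongr
  have b2 : ∀ j : Fin d, ‖duhamel (burgersOp p j) (fun s => sqLp (ballProj N (U s))) t‖ ≤
      C₂ / (1 - α) * ((N : ℝ) ^ 2 * T ^ (1 - α)) := by
    intro j
    refine (norm_duhamel_le hα (h₂ j) (fun r _ => norm_sqLp_ballProj_le N (U r)) ht).trans ?_
    have : t ^ (1 - α) ≤ T ^ (1 - α) := Real.rpow_le_rpow ht.1 ht.2 hα'.le
    calc _ ≤ C₂ * (N : ℝ) ^ 2 * (T ^ (1 - α) / (1 - α)) := by gcongr
      _ = _ := by ring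
  have b3 : ‖∑ j : Fin d, duhamel (burgersOp p j) (fun s => sqLp (ballProj N (U s))) t‖ ≤
      C₂ / (1 - α) * (d * (N : ℝ) ^ 2 * T ^ (1 - α)) := by
    refine (norm_sum_le _ _).trans ((Finset.sum_le_sum fun j _ => b2 j).trans (le_of_eq ?_))
    rw [Finset.sum_const, Finset.card_univ, Fintype.card_fin, nsmul_eq_mul]
    ring
  have hx : 0 ≤ T * N := by positivity
  have hy : 0 ≤ d * (N : ℝ) ^ 2 * T ^ (1 - α) := by positivity
  have hc : 0 ≤ C₂ / (1 - α) := by positivity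
  have hu := norm_nonneg u₀
  calc _ ≤ ‖lksEvol u₀ t‖ +
        (1 / 2 * ‖duhamel (semigroupOp d p) (fun s => ballProj N (U s)) t‖ +
        1 / 2 * ‖∑ j : Fin d, duhamel (burgersOp p j) (fun s => sqLp (ballProj N (U s))) t‖) := by
        refine (norm_add_le _ _).trans (add_le_add_right ((norm_add_le _ _).trans (le_of_eq ?_)) _)
        rw [norm_smul, norm_smul, Real.norm_of_nonneg (by norm_num : (0 : ℝ) ≤ 1 / 2)]
    _ ≤ (1 + C₁) * ‖u₀‖ + C₁ * (T * N) +
        C₂ / (1 - α) * (d * (N : ℝ) ^ 2 * T ^ (1 - α)) := by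
        linarith [norm_nonneg (duhamel (semigroupOp d p) (fun s => ballProj N (U s)) t),
          norm_nonneg (∑ j : Fin d, duhamel (burgersOp p j) (fun s => sqLp (ballProj N (U s))) t)]
    _ ≤ _ := by
        nlinarith [mul_nonneg hc hu, mul_nonneg hc hx, mul_nonneg hC₁ hy]

end MildSolution

end

theorem mainTheorem3 (d : ℕ) (hd : 0 < d) (p : ℝ) [Fact (1 ≤ p)] (hdp : (d : ℝ) < 6 * p)
    (T : ℝ) (hT : 0 < T) :
    ∃ C : ℝ, 0 < C ∧ ∀ (u₀ : L2p d p) (N : ℕ), 0 < N →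
      ∃ U : ℝ → L2p d p,
        IsTruncatedMildSolution T N u₀ U ∧
        (∀ V : ℝ → L2p d p, IsTruncatedMildSolution T N u₀ V → Set.EqOn V U (Set.Icc 0 T)) ∧
        (∀ t ∈ Set.Icc 0 T,
          ‖U t‖ ≤ C * (‖u₀‖ + T * N + d * (N : ℝ) ^ 2 * T ^ ((6 * p - d) / (8 * p)))) := by
  obtain ⟨C, hC, hbound⟩ := exists_norm_mild_rhs_le (p := p) hdp hT
  refine ⟨C, hC, fun u₀ N _ => ?_⟩
  obtain ⟨C', hC', hop⟩ := exists_norm_mildOp_le d p hT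
  obtain ⟨U, ⟨hUc, hU⟩, huniq⟩ := exists_unique_volterra hT.le
    (lksDeriv_exponent_lt (Fact.out : 1 ≤ p) hdp) (continuousOn_mildOp T) hop hC'
    ((continuousOn_lksEvol u₀).mono Icc_subset_Ici_self) (lipschitzWith_truncNonlin N)
  refine ⟨U, (isTruncatedMildSolution_iff hdp u₀ U).2 ⟨hUc, hU⟩, fun V hV => ?_, fun t ht => ?_⟩
  · have h := (isTruncatedMildSolution_iff hdp u₀ V).1 hV
    exact huniq V h.1 h.2
  · rw [hU t ht]
    exact hbound u₀ N U hUc t ht
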